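/- Let $X$ be a complex Banach space with Fourier type $p\in[1,2]$, i.e. for some $n\ge 1$ the Fourier transform extends from $L^1(\mathbb R^n;X)\cap L^p(\mathbb R^n;X)$ to a bounded operator $L^p(\mathbb R^n;X)\to L^{p'}(\mathbb R^n;X)$, where $\frac1p+\frac1{p'}=1$. Let $(T(t))_{t\ge0}$ be a $C_0$-semigroup on $X$ with generator $A$. Suppose that every $\lambda\in\mathbb C$ with $\operatorname{Re}\lambda\ge0$ belongs to the resolvent set $\rho(A)$, and that $\sup_{\operatorname{Re}\lambda\ge0}\|R(\lambda,A)\|_{\mathcal L(X)}<\infty$, where $R(\lambda,A)=(\lambda-A)^{-1}$. Put $\alpha=\frac1p-\frac1{p'}\in[0,1]$, let $(-A)^\alpha$ be the fractional power of $-A$ (with $(-A)^0=I_X$ and $(-A)^1=-A$), and let $\|x\|_{D((-A)^\alpha)}=\|x\|_X+\|(-A)^\alpha x\|_X$. Then there exist $C\ge0$ and $\omega<0$ such that $$\|T(t)x\|_X\le C e^{\omega t}\,\|x\|_{D((-A)^{\alpha})}$$ for all $x\in D((-A)^{\alpha})$ and all $t\ge0$. -/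

import Mathlib

open scoped ENNReal NNReal FourierTransform Topology
open MeasureTheory Set Filter

namespace EvolutionEq

noncomputable section

/-- `T`, restricted to `[0, ∞)`, is a strongly continuous (that is, `C₀`-) semigroup of bounded
operators on `X`. The values of `T` at negative times play no role. -/
structure IsC0Semigroup {X : Type*} [NormedAddCommGroup X] [NormedSpace ℂ X]
    (T : ℝ → X →L[ℂ] X) : Prop where
  map_zero : T 0 = ContinuousLinearMap.id ℂ X
  map_add : ∀ s t : ℝ, 0 ≤ s → 0 ≤ t → T (s + t) = (T s).comp (T t)
  continuousOn_orbit : ∀ x : X, ContinuousOn (fun t : ℝ => T t x) (Ici 0)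

/-- The graph of the generator: all pairs `(x, y)` with `y = lim_{h ↓ 0} (T(h)x - x)/h`. -/
def generatorGraph {X : Type*} [NormedAddCommGroup X] [NormedSpace ℂ X]
    (T : ℝ → X →L[ℂ] X) : Submodule ℂ (X × X) where
  carrier := {z | Tendsto (fun h : ℝ => (h : ℂ)⁻¹ • (T h z.1 - z.1)) (𝓝[>] 0) (𝓝 z.2)}
  zero_mem' := by simp
  add_mem' := by
    intro a b ha hb
    refine (Tendsto.add ha hb).congr fun h => ?_
    simp only [Prod.fst_add, _root_.map_add, ← smul_add]
    congr 1
    abel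
  smul_mem' := by
    intro c a ha
    refine (Tendsto.const_smul ha c).congr fun h => ?_
    simp only [Prod.smul_fst, _root_.map_smul, ← smul_sub]
    exact smul_comm _ _ _

/-- The generator `A` of `T`: its domain `D(A)` consists of those `x` for which
`lim_{h ↓ 0} (T(h)x - x)/h` exists, and `A x` is this limit. -/
def generator {X : Type*} [NormedAddCommGroup X] [NormedSpace ℂ X]
    (T : ℝ → X →L[ℂ] X) : X →ₗ.[ℂ] X :=
  (generatorGraph T).toLinearPMap

theorem mem_graph_generator_iff {X : Type*} [NormedAddCommGroup X] [NormedSpace ℂ X]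
    (T : ℝ → X →L[ℂ] X) (x y : X) :
    (x, y) ∈ (generator T).graph ↔
      Tendsto (fun h : ℝ => (h : ℂ)⁻¹ • (T h x - x)) (𝓝[>] 0) (𝓝 y) := by
  unfold generator
  rw [Submodule.toLinearPMap_graph_eq]
  · rfl
  · rintro ⟨a, b⟩ hab (rfl : a = 0)
    have h : Tendsto (fun h : ℝ => (h : ℂ)⁻¹ • (T h (0 : X) - 0)) (𝓝[>] 0) (𝓝 b) := hab
    simp only [_root_.map_zero, sub_zero, smul_zero] at h
    exact tendsto_nhds_unique h tendsto_const_nhds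

/-- `R` is a bounded two-sided inverse of `z - A : D(A) → X`. -/
structure IsResolventAt {X : Type*} [NormedAddCommGroup X] [NormedSpace ℂ X]
    (A : X →ₗ.[ℂ] X) (z : ℂ) (R : X →L[ℂ] X) : Prop where
  right_inv : ∀ y : X, ∃ h : R y ∈ A.domain, z • R y - A ⟨R y, h⟩ = y
  left_inv : ∀ x : A.domain, R (z • (x : X) - A x) = x

theorem IsResolventAt.unique {X : Type*} [NormedAddCommGroup X] [NormedSpace ℂ X]
    {A : X →ₗ.[ℂ] X} {z : ℂ} {R S : X →L[ℂ] X}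
    (hR : IsResolventAt A z R) (hS : IsResolventAt A z S) : R = S := by
  ext y
  obtain ⟨h, hy⟩ := hS.right_inv y
  have := hR.left_inv ⟨S y, h⟩
  rwa [hy] at this

/-- The resolvent set `ρ(A)` of an (unbounded) operator `A` on `X`. -/
def resolventSet {X : Type*} [NormedAddCommGroup X] [NormedSpace ℂ X]
    (A : X →ₗ.[ℂ] X) : Set ℂ :=
  {z | ∃ R : X →L[ℂ] X, IsResolventAt A z R}

open Classical in
/-- The resolvent operator `R(z, A) = (z - A)⁻¹` for `z ∈ ρ(A)` (and `0` for `z ∉ ρ(A)`). -/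
def resolvent {X : Type*} [NormedAddCommGroup X] [NormedSpace ℂ X]
    (A : X →ₗ.[ℂ] X) (z : ℂ) : X →L[ℂ] X :=
  if h : ∃ R : X →L[ℂ] X, IsResolventAt A z R then h.choose else 0

theorem isResolventAt_resolvent {X : Type*} [NormedAddCommGroup X] [NormedSpace ℂ X]
    {A : X →ₗ.[ℂ] X} {z : ℂ} (hz : z ∈ resolventSet A) :
    IsResolventAt A z (resolvent A z) := by
  have h : ∃ R : X →L[ℂ] X, IsResolventAt A z R := hz
  unfold resolvent
  rw [dif_pos h]
  exact h.choose_spec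

/-- Balakrishnan's formula for the negative fractional power of `-A`, for `0 < α < 1`:
`(-A)^{-α} = (sin (π α) / π) ∫_0^∞ t^{-α} R(t, A) dt`.
The integral converges in operator norm if `[0, ∞) ⊆ ρ(A)` and `(1 + t) ‖R(t, A)‖` is bounded for
`t ≥ 0`; this is the case for a semigroup generator `A` with `[0, ∞) ⊆ ρ(A)`. -/
def negFracPow {X : Type*} [NormedAddCommGroup X] [NormedSpace ℂ X]
    (A : X →ₗ.[ℂ] X) (α : ℝ) : X →L[ℂ] X :=
  ((Real.sin (Real.pi * α) / Real.pi : ℝ) : ℂ) •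
    ∫ t : ℝ in Ioi 0, ((t ^ (-α) : ℝ) : ℂ) • resolvent A (t : ℂ)

open Classical in
/-- The fractional power `(-A)^α` for `0 ≤ α ≤ 1`, as an unbounded operator: the identity of `X`
for `α = 0`, the operator `-A` for `α = 1`, and the inverse of the bounded injective operator
`(-A)^{-α}` (with domain the range of the latter) for `0 < α < 1`. -/
def fracPow {X : Type*} [NormedAddCommGroup X] [NormedSpace ℂ X]
    (A : X →ₗ.[ℂ] X) (α : ℝ) : X →ₗ.[ℂ] X :=
  if α = 0 then (LinearMap.id : X →ₗ[ℂ] X).toPMap ⊤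
  else if α = 1 then -A
  else (((negFracPow A α : X →L[ℂ] X) : X →ₗ[ℂ] X).toPMap ⊤).inverse

/-- The graph norm `‖x‖_{D(B)} = ‖x‖ + ‖B x‖` on the domain of an operator `B`. -/
def graphNorm {X : Type*} [NormedAddCommGroup X] [NormedSpace ℂ X]
    (B : X →ₗ.[ℂ] X) (x : B.domain) : ℝ :=
  ‖(x : X)‖ + ‖B x‖

/-- `X` has Fourier type `p` (with respect to `ℝⁿ`, `n ≥ 1`): the Fourier transform, given by its
integral formula on the dense subspace `L¹(ℝⁿ; X) ∩ Lᵖ(ℝⁿ; X)`, extends to a bounded operator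
from `Lᵖ(ℝⁿ; X)` to `L^{p'}(ℝⁿ; X)`, where `p'` is the Hölder conjugate of `p`. The normalization
`e^{-2 π i x · ξ}` or `e^{-i x · ξ}` of the Fourier transform only affects the constant. -/
def HasFourierType (n : ℕ) (X : Type*) [NormedAddCommGroup X] [NormedSpace ℂ X]
    (p : ℝ≥0∞) : Prop :=
  ∃ C : ℝ≥0, ∀ f : EuclideanSpace ℝ (Fin n) → X, Integrable f volume → MemLp f p volume →
    eLpNorm (𝓕 f) (ENNReal.conjExponent p) volume ≤ C * eLpNorm f p volume

end

end EvolutionEq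

/-! The resolvent bound extends by a Neumann series to a half-plane `Re z > -a`, so decay `e^{-εt}`
should come from inverting the Laplace transform on `Re z = -ε`. Boundedness of the resolvent gives
no convergence there; Fourier type, used twice, does. Let `q = p'`. Far to the right, `R(σ + i·)x`
is the Fourier transform of `e^{-σt}T(t)x`, a function in `Lᵖ`, so it lies in `L^q`; by the
resolvent identity so does `R(-ε + i·)x` (`exists_eLpNorm_resolvent_vertical_le`). A scalar kernel
in `L^{1/α}`, with `α = 1/p - 1/q`, moves it into `Lᵖ` by Hölder, and Fourier type puts the inverse
transform back into `L^q`. The semigroup law turns this into a pointwise bound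
(`exists_norm_expConv_sub_le`).

The function inverted is `expConv T l x - expConv T m x`. Since `expConv T l x` has Laplace
transform `(z + l)⁻¹ R(z)x`, the difference carries a kernel of quadratic decay, so inversion and
contour shift converge absolutely for every `x : X`. Letting `m → ∞` removes the second term. For `0
< α < β < 1` the kernel norms are `O(l^{β-1})`, whence `‖T(t)R(l)‖ ≲ l^{β-1}e^{-εt}`.

If `α = 0`, then `β = 0` is allowed and `l • expConv T l x t → T(t)x` concludes. If `α = 1`, no `β <
1` is available: `m` is instead chosen exponentially large in `t`, and `x = R(1)(x - Ax)`. If `0 < α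
< 1`, `T(t)R(l)` is integrated against `l^{-α}` in Balakrishnan's formula; since `l^{β-1-α}` just
fails to be integrable at infinity, the bound is first interpolated with the trivial bound
`l^{-1}e^{ωt}` (`exists_decay_negFracPow`). Recovering `x` as `(-A)^{-α}(-A)^α x` requires
`(-A)^{-α}` to be injective, which a Frullani integral shows
(`eq_zero_of_negFracPow_apply_eq_zero`). -/

namespace EvolutionEq

/-! ### Resolvent identity, perturbation and regularity of the resolvent. -/

section Resolvent

variable {X : Type*} [NormedAddCommGroup X] [NormedSpace ℂ X] {A : X →ₗ.[ℂ] X}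

theorem resolvent_mem_graph {z : ℂ} (hz : z ∈ resolventSet A) (y : X) :
    (resolvent A z y, z • resolvent A z y - y) ∈ A.graph := by
  obtain ⟨h, hy⟩ := (isResolventAt_resolvent hz).right_inv y
  rw [LinearPMap.mem_graph_iff]
  exact ⟨⟨_, h⟩, rfl, eq_sub_of_add_eq (sub_eq_iff_eq_add'.1 hy).symm⟩

theorem resolvent_apply_of_mem_graph {z : ℂ} (hz : z ∈ resolventSet A) {v y : X}
    (h : (v, y) ∈ A.graph) : resolvent A z (z • v - y) = v := by
  obtain ⟨v', rfl, rfl⟩ := LinearPMap.mem_graph_iff _ |>.1 h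
  exact (isResolventAt_resolvent hz).left_inv v'

theorem resolvent_apply_sub {z w : ℂ} (hz : z ∈ resolventSet A) (hw : w ∈ resolventSet A) (y : X) :
    resolvent A z y - resolvent A w y = (w - z) • resolvent A z (resolvent A w y) := by
  have h := resolvent_apply_of_mem_graph hz (resolvent_mem_graph hw y)
  have e : z • resolvent A w y - (w • resolvent A w y - y) = y - (w - z) • resolvent A w y := by
    rw [sub_smul]; abel
  rw [e, map_sub, map_smul] at h
  exact sub_eq_of_eq_add' (sub_eq_iff_eq_add.1 h)

theorem resolvent_sub {z w : ℂ} (hz : z ∈ resolventSet A) (hw : w ∈ resolventSet A) :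
    resolvent A z - resolvent A w = (w - z) • (resolvent A z).comp (resolvent A w) := by
  ext y
  simpa using resolvent_apply_sub hz hw y

theorem resolvent_injective {z : ℂ} (hz : z ∈ resolventSet A) :
    Function.Injective (resolvent A z) := by
  rw [injective_iff_map_eq_zero]
  intro y hy
  obtain ⟨h, h'⟩ := (isResolventAt_resolvent hz).right_inv y
  have : (⟨resolvent A z y, h⟩ : A.domain) = 0 := Subtype.ext hy
  rw [this, hy] at h'
  simpa using h'.symm

theorem resolvent_eq_of_isResolventAt {z : ℂ} {S : X →L[ℂ] X} (h : IsResolventAt A z S) :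
    resolvent A z = S :=
  (isResolventAt_resolvent ⟨S, h⟩).unique h

/-- Neumann series perturbation of a resolvent operator. -/
theorem mem_resolventSet_of_near [CompleteSpace X] {z w : ℂ} {M : ℝ} (hz : z ∈ resolventSet A)
    (hM : ‖resolvent A z‖ ≤ M) (hzw : ‖z - w‖ * M ≤ 1 / 2) :
    w ∈ resolventSet A ∧ ‖resolvent A w‖ ≤ 2 * M := by
  set R := resolvent A z with hR
  set t : X →L[ℂ] X := (z - w) • R with ht
  have hM0 : 0 ≤ M := (norm_nonneg _).trans hM
  have htn : ‖t‖ ≤ 1 / 2 := by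
    rw [ht, norm_smul]
    exact (mul_le_mul_of_nonneg_left hM (norm_nonneg _)).trans hzw
  have htn1 : ‖t‖ < 1 := htn.trans_lt (by norm_num)
  set u := Units.oneSub t htn1 with hu
  have huv : (u : X →L[ℂ] X) = 1 - t := rfl
  set N : X →L[ℂ] X := ((u⁻¹ : (X →L[ℂ] X)ˣ) : X →L[ℂ] X) with hN
  have h1 : ∀ y, N y - (z - w) • R (N y) = y := by
    intro y
    have := congrArg (fun f : X →L[ℂ] X => f y) u.mul_inv
    simpa [huv, ht] using this
  have h2 : ∀ y, N (y - (z - w) • R y) = y := by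
    intro y
    have := congrArg (fun f : X →L[ℂ] X => f y) u.inv_mul
    simpa [huv, ht] using this
  have hres : IsResolventAt A w (R.comp N) := by
    constructor
    · intro y
      obtain ⟨h, hy⟩ := (isResolventAt_resolvent hz).right_inv (N y)
      refine ⟨h, ?_⟩
      calc w • R (N y) - A ⟨R (N y), h⟩
          = (z • R (N y) - A ⟨R (N y), h⟩) - (z - w) • R (N y) := by rw [sub_smul]; abel
        _ = y := by rw [hy, h1]
    · intro x
      have hx := (isResolventAt_resolvent hz).left_inv x
      rw [← hR] at hx
      have := h2 (z • (x : X) - A x)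
      rw [hx] at this
      have e : w • (x : X) - A x = z • (x : X) - A x - (z - w) • (x : X) := by
        rw [sub_smul]; abel
      rw [e, ContinuousLinearMap.comp_apply, this, hx]
  refine ⟨⟨_, hres⟩, ?_⟩
  rw [resolvent_eq_of_isResolventAt hres]
  refine ContinuousLinearMap.opNorm_le_bound _ (by positivity) fun y => ?_
  have hq : ‖N y‖ ≤ 2 * ‖y‖ := by
    have e : N y = y + t (N y) := by
      rw [ht]; nth_rewrite 2 [← h1 y]; simp
    have h3 : ‖N y‖ ≤ ‖y‖ + ‖t‖ * ‖N y‖ := by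
      nth_rewrite 1 [e]
      exact (norm_add_le _ _).trans (by gcongr; exact t.le_opNorm _)
    nlinarith [norm_nonneg (N y), norm_nonneg y]
  calc ‖R (N y)‖ ≤ ‖R‖ * ‖N y‖ := R.le_opNorm _
    _ ≤ M * (2 * ‖y‖) := by gcongr
    _ = 2 * M * ‖y‖ := by ring

/-- A resolvent bounded on the closed right half-plane is bounded on a larger half-plane. -/
theorem exists_halfPlane_bound [CompleteSpace X] (hρ : ∀ z : ℂ, 0 ≤ z.re → z ∈ resolventSet A)
    {M : ℝ} (hR : ∀ z : ℂ, 0 ≤ z.re → ‖resolvent A z‖ ≤ M) :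
    ∃ a K : ℝ, 0 < a ∧ a ≤ 1 ∧ 1 ≤ K ∧ ∀ z : ℂ, -a < z.re →
      z ∈ resolventSet A ∧ ‖resolvent A z‖ ≤ K := by
  -- The maximum with 1 forces `a ≤ 1`, so that `ε = a / 2` will satisfy `ε ≤ 1 / 2`.
  set M' := max M 1 with hM'
  have h1 : 1 ≤ M' := le_max_right _ _
  refine ⟨1 / (2 * M'), 2 * M', by positivity, ?_, by linarith, fun z hz => ?_⟩
  · rw [div_le_one (by positivity)]; linarith
  · by_cases h : 0 ≤ z.re
    · exact ⟨hρ z h, (hR z h).trans ((le_max_left _ _).trans (by linarith))⟩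
    · push Not at h
      -- The perturbation starts from the point of the imaginary axis at the height of `z`.
      have h0 : 0 ≤ ((z.im : ℂ) * Complex.I).re := by simp
      refine mem_resolventSet_of_near (hρ _ h0) ((hR _ h0).trans (le_max_left _ _)) ?_
      have : (z.im : ℂ) * Complex.I - z = ((-z.re : ℝ) : ℂ) := by
        apply Complex.ext <;> simp
      rw [this, Complex.norm_real, Real.norm_of_nonneg (by linarith)]
      calc -z.re * M' ≤ (1 / (2 * M')) * M' := by gcongr; linarith
        _ = 1 / 2 := by field_simp

section HalfPlane

variable {a M : ℝ} (hA : ∀ z : ℂ, -a < z.re → z ∈ resolventSet A ∧ ‖resolvent A z‖ ≤ M)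
include hA

theorem continuousAt_resolvent {z : ℂ} (hz : -a < z.re) : ContinuousAt (resolvent A) z := by
  have hM0 : 0 ≤ M := (norm_nonneg _).trans (hA z hz).2
  have hU : {w : ℂ | -a < w.re} ∈ 𝓝 z :=
    (isOpen_lt continuous_const Complex.continuous_re).mem_nhds hz
  rw [ContinuousAt, tendsto_iff_norm_sub_tendsto_zero]
  have h0 : Tendsto (fun w : ℂ => ‖z - w‖ * (M * M)) (𝓝 z) (𝓝 0) := by
    have : Continuous fun w : ℂ => ‖z - w‖ * (M * M) := by fun_prop
    simpa using this.tendsto z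
  refine squeeze_zero' (Eventually.of_forall fun _ => norm_nonneg _) ?_ h0
  filter_upwards [hU] with w hw
  rw [resolvent_sub (hA w hw).1 (hA z hz).1, norm_smul]
  gcongr
  exact (ContinuousLinearMap.opNorm_comp_le _ _).trans
    (mul_le_mul (hA w hw).2 (hA z hz).2 (norm_nonneg _) hM0)

theorem hasDerivAt_resolvent {z : ℂ} (hz : -a < z.re) :
    HasDerivAt (resolvent A) (-(resolvent A z).comp (resolvent A z)) z := by
  have hU : {w : ℂ | -a < w.re} ∈ 𝓝 z :=
    (isOpen_lt continuous_const Complex.continuous_re).mem_nhds hz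
  rw [hasDerivAt_iff_tendsto_slope]
  have h1 : Tendsto (fun w => -(resolvent A w).comp (resolvent A z)) (𝓝[≠] z)
      (𝓝 (-(resolvent A z).comp (resolvent A z))) := by
    have hc : ContinuousAt (fun w => -(resolvent A w).comp (resolvent A z)) z :=
      ((continuousAt_resolvent hA hz).clm_comp continuousAt_const).neg
    exact hc.tendsto.mono_left nhdsWithin_le_nhds
  refine h1.congr' ?_
  filter_upwards [self_mem_nhdsWithin, nhdsWithin_le_nhds hU] with w hne hw
  have hne' : w - z ≠ 0 := sub_ne_zero.2 hne
  rw [slope_def_module, resolvent_sub (hA w hw).1 (hA z hz).1, smul_smul,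
    ← neg_sub w z, mul_neg, inv_mul_cancel₀ hne', neg_one_smul]

theorem continuous_resolvent_vertical {σ : ℝ} (hσ : -a < σ) (c : ℝ) :
    Continuous fun s : ℝ => resolvent A (σ + (c * s : ℝ) * Complex.I) := by
  rw [continuous_iff_continuousAt]
  intro s
  refine ContinuousAt.comp (g := resolvent A) (continuousAt_resolvent hA (by simpa using hσ)) ?_
  exact Continuous.continuousAt (by fun_prop)

theorem continuousOn_resolvent_real :
    ContinuousOn (fun t : ℝ => resolvent A (t : ℂ)) (Ioi (-a)) := by
  intro t ht
  refine ContinuousAt.continuousWithinAt ?_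
  exact ContinuousAt.comp (g := resolvent A) (continuousAt_resolvent hA (by simpa using ht))
    Complex.continuous_ofReal.continuousAt

end HalfPlane

end Resolvent

/-! ### Growth bound, orbits and Laplace transform of the semigroup. -/

section Semigroup

variable {X : Type*} [NormedAddCommGroup X] [NormedSpace ℂ X] {T : ℝ → X →L[ℂ] X}

namespace IsC0Semigroup

theorem continuous_orbit_max (hT : IsC0Semigroup T) (x : X) :
    Continuous fun t : ℝ => T (max t 0) x :=
  (hT.continuousOn_orbit x).comp_continuous (by fun_prop) fun t => le_max_right t 0

theorem exists_growth_bound [CompleteSpace X] (hT : IsC0Semigroup T) :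
    ∃ M ω : ℝ, 1 ≤ M ∧ 1 ≤ ω ∧ ∀ t : ℝ, 0 ≤ t → ‖T t‖ ≤ M * Real.exp (ω * t) := by
  obtain ⟨C', hC'⟩ := banach_steinhaus (g := fun t : Icc (0 : ℝ) 1 => T t) (by
    intro x
    obtain ⟨C, hC⟩ := isCompact_Icc.exists_bound_of_continuousOn
      ((hT.continuousOn_orbit x).mono fun _ (h : _ ∈ Icc (0 : ℝ) 1) => h.1)
    exact ⟨C, fun i => hC i i.2⟩)
  set C := max C' 1 with hCdef
  have hC1 : 1 ≤ C := le_max_right _ _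
  have hC : ∀ t : ℝ, 0 ≤ t → t ≤ 1 → ‖T t‖ ≤ C := fun t h0 h1 =>
    (hC' ⟨t, h0, h1⟩).trans (le_max_left _ _)
  have hn : ∀ n : ℕ, ∀ t : ℝ, 0 ≤ t → t ≤ n + 1 → ‖T t‖ ≤ C ^ (n + 1) := by
    intro n
    induction n with
    | zero => intro t h0 h1; simpa using hC t h0 (by simpa using h1)
    | succ n ih =>
      intro t h0 h1
      by_cases h : t ≤ n + 1
      · exact (ih t h0 h).trans (pow_le_pow_right₀ hC1 (by omega))
      · push Not at h
        push_cast at h1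
        have hn0 : (0 : ℝ) ≤ n := Nat.cast_nonneg n
        have e : t = 1 + (t - 1) := by ring
        rw [e, hT.map_add 1 (t - 1) zero_le_one (by linarith)]
        refine (ContinuousLinearMap.opNorm_comp_le _ _).trans ?_
        rw [pow_succ' C (n + 1)]
        exact mul_le_mul (hC 1 zero_le_one le_rfl) (ih (t - 1) (by linarith) (by linarith))
          (norm_nonneg _) (by linarith)
  -- The summand 1 serves only to give `ω ≥ 1`.
  refine ⟨C, Real.log C + 1, hC1, by linarith [Real.log_nonneg hC1], fun t ht => ?_⟩
  refine (hn ⌊t⌋₊ t ht (Nat.lt_floor_add_one t).le).trans ?_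
  rw [pow_succ']
  gcongr
  have h1 : C ^ ⌊t⌋₊ = Real.exp (Real.log C * ⌊t⌋₊) := by
    rw [mul_comm, Real.exp_nat_mul, Real.exp_log (by linarith)]
  rw [h1]
  apply Real.exp_le_exp.2
  have := mul_le_mul_of_nonneg_left (Nat.floor_le ht) (Real.log_nonneg hC1)
  linarith

/-- The right derivative is immediate from `T(s) = T(t)T(s - t)`, and it suffices for the
fundamental theorem of calculus on continuous orbits. -/
theorem hasDerivWithinAt_orbit (hT : IsC0Semigroup T) {v y : X}
    (h : (v, y) ∈ (generator T).graph) {t : ℝ} (ht : 0 ≤ t) :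
    HasDerivWithinAt (fun s => T s v) (T t y) (Ioi t) t := by
  rw [hasDerivWithinAt_iff_tendsto_slope' (by simp)]
  rw [mem_graph_generator_iff] at h
  have h1 : Tendsto (fun s : ℝ => s - t) (𝓝[>] t) (𝓝[>] 0) := by
    refine tendsto_nhdsWithin_iff.2 ⟨?_, ?_⟩
    · have : Continuous fun s : ℝ => s - t := by fun_prop
      simpa using (this.tendsto t).mono_left nhdsWithin_le_nhds
    · filter_upwards [self_mem_nhdsWithin] with s hs
      exact sub_pos.2 (mem_Ioi.1 hs)
  have h2 := ((T t).continuous.tendsto y).comp (h.comp h1)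
  refine h2.congr' ?_
  filter_upwards [self_mem_nhdsWithin] with s hs
  have hs' : 0 ≤ s - t := (sub_pos.2 (mem_Ioi.1 hs)).le
  have e : T s v = T t (T (s - t) v) := by
    rw [← ContinuousLinearMap.comp_apply, ← hT.map_add t (s - t) ht hs', add_sub_cancel]
  rw [slope_def_module, e, ← map_sub, Function.comp_apply, Function.comp_apply, map_smul,
    ← Complex.ofReal_inv, Complex.coe_smul]

theorem continuousOn_cexp_smul_orbit (hT : IsC0Semigroup T) (c : ℂ) (x : X) :
    ContinuousOn (fun s : ℝ => Complex.exp (c * s) • T s x) (Ici 0) :=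
  ContinuousOn.smul (by fun_prop) (hT.continuousOn_orbit x)

theorem intervalIntegrable_cexp_smul_orbit (hT : IsC0Semigroup T) (c : ℂ) (x : X) {s t : ℝ}
    (hs : 0 ≤ s) (ht : 0 ≤ t) :
    IntervalIntegrable (fun s : ℝ => Complex.exp (c * s) • T s x) volume s t :=
  ((hT.continuousOn_cexp_smul_orbit c x).mono fun _ hr =>
    (le_min hs ht).trans hr.1).intervalIntegrable

theorem integral_cexp_smul_orbit [CompleteSpace X] (hT : IsC0Semigroup T) {v y : X}
    (h : (v, y) ∈ (generator T).graph) (c : ℂ) {t : ℝ} (ht : 0 ≤ t) :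
    ∫ s in (0 : ℝ)..t, Complex.exp (c * s) • T s (c • v + y) = Complex.exp (c * t) • T t v - v := by
  have h0 : v = Complex.exp (c * (0 : ℝ)) • T 0 v := by simp [hT.map_zero]
  nth_rewrite 3 [h0]
  refine intervalIntegral.integral_eq_sub_of_hasDeriv_right
    (f := fun s : ℝ => Complex.exp (c * s) • T s v)
    ((hT.continuousOn_cexp_smul_orbit c v).mono fun _ hr => (le_min le_rfl ht).trans hr.1) ?_
    (hT.intervalIntegrable_cexp_smul_orbit c _ le_rfl ht)
  intro s hs
  have hs0 : 0 ≤ s := (le_min le_rfl ht).trans hs.1.le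
  have h1 : HasDerivAt (fun s : ℝ => Complex.exp (c * s)) (Complex.exp (c * s) * c) s := by
    have : HasDerivAt (fun s : ℝ => c * (s : ℂ)) c s := by
      simpa using (Complex.ofRealCLM.hasDerivAt (x := s)).const_mul c
    exact this.cexp
  have h2 := h1.hasDerivWithinAt.smul (hT.hasDerivWithinAt_orbit h hs0)
  refine h2.congr_deriv ?_
  rw [_root_.map_add, map_smul, smul_add, smul_smul, add_comm]

theorem norm_cexp_smul_orbit_le {M ω : ℝ} (hM : ∀ t : ℝ, 0 ≤ t → ‖T t‖ ≤ M * Real.exp (ω * t))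
    (z : ℂ) (x : X) {t : ℝ} (ht : 0 ≤ t) :
    ‖Complex.exp (-z * t) • T t x‖ ≤ M * ‖x‖ * Real.exp (-(z.re - ω) * t) := by
  rw [norm_smul, Complex.norm_exp]
  have e : (-z * t).re = -z.re * t := by simp
  rw [e]
  calc Real.exp (-z.re * t) * ‖T t x‖ ≤ Real.exp (-z.re * t) * (M * Real.exp (ω * t) * ‖x‖) := by
        gcongr
        exact (T t).le_of_opNorm_le (hM t ht) x
    _ = M * ‖x‖ * Real.exp (-(z.re - ω) * t) := by
        rw [show -(z.re - ω) * t = -z.re * t + ω * t by ring, Real.exp_add]; ring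

theorem integrableOn_cexp_smul_orbit (hT : IsC0Semigroup T) {M ω : ℝ}
    (hM : ∀ t : ℝ, 0 ≤ t → ‖T t‖ ≤ M * Real.exp (ω * t)) {z : ℂ} (hz : ω < z.re) (x : X) :
    IntegrableOn (fun t : ℝ => Complex.exp (-z * t) • T t x) (Ioi 0) := by
  have h1 : IntegrableOn (fun t : ℝ => M * ‖x‖ * Real.exp (-(z.re - ω) * t)) (Ioi 0) :=
    (exp_neg_integrableOn_Ioi 0 (sub_pos.2 hz)).const_mul _
  refine Integrable.mono' h1 (((hT.continuousOn_cexp_smul_orbit (-z) x).mono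
    Ioi_subset_Ici_self).aestronglyMeasurable measurableSet_Ioi) ?_
  filter_upwards [self_mem_ae_restrict measurableSet_Ioi] with t ht
  exact norm_cexp_smul_orbit_le hM z x (le_of_lt ht)

theorem integral_laplace [CompleteSpace X] (hT : IsC0Semigroup T) {M ω : ℝ}
    (hM : ∀ t : ℝ, 0 ≤ t → ‖T t‖ ≤ M * Real.exp (ω * t)) {z : ℂ} (hz : ω < z.re)
    (hzρ : z ∈ resolventSet (generator T)) (x : X) :
    ∫ t in Ioi (0 : ℝ), Complex.exp (-z * t) • T t x = resolvent (generator T) z x := by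
  set v := resolvent (generator T) z x with hv
  have hg : (v, z • v - x) ∈ (generator T).graph := resolvent_mem_graph hzρ x
  have h1 := intervalIntegral_tendsto_integral_Ioi 0 (hT.integrableOn_cexp_smul_orbit hM hz x)
    tendsto_id
  have h2 : Tendsto (fun t : ℝ => v - Complex.exp (-z * t) • T t v) atTop (𝓝 (v - 0)) := by
    refine tendsto_const_nhds.sub (squeeze_zero_norm' (a := fun t : ℝ =>
      M * ‖v‖ * Real.exp (-(z.re - ω) * t)) ?_ ?_)
    · filter_upwards [eventually_ge_atTop 0] with t ht using norm_cexp_smul_orbit_le hM z v ht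
    · have : Tendsto (fun t : ℝ => -(z.re - ω) * t) atTop atBot :=
        tendsto_id.const_mul_atTop_of_neg (by linarith)
      simpa using (Real.tendsto_exp_atBot.comp this).const_mul (M * ‖v‖)
  rw [sub_zero] at h2
  refine tendsto_nhds_unique h1 (h2.congr' ?_)
  filter_upwards [eventually_ge_atTop 0] with t ht
  have h3 := hT.integral_cexp_smul_orbit hg (-z) ht
  have e : -z • v + (z • v - x) = -x := by rw [neg_smul]; abel
  rw [e] at h3
  simp only [map_neg, smul_neg, intervalIntegral.integral_neg] at h3
  rw [id, ← neg_inj, h3]; abel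

end IsC0Semigroup

/-- For `t > 2ω` the Laplace integral gives `M / (t - ω)`, and `1 + t ≤ 3(t - ω)` because `ω ≥ 1`;
smaller `t` are covered by `K`. -/
theorem exists_resolvent_real_decay [CompleteSpace X] (hT : IsC0Semigroup T) {a K : ℝ} (ha : 0 < a)
    (hA : ∀ z : ℂ, -a < z.re →
      z ∈ resolventSet (generator T) ∧ ‖resolvent (generator T) z‖ ≤ K) :
    ∃ C : ℝ, 0 < C ∧ ∀ t : ℝ, 0 ≤ t → ‖resolvent (generator T) (t : ℂ)‖ ≤ C / (1 + t) := by
  obtain ⟨M, ω, hM1, hω1, hM⟩ := hT.exists_growth_bound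
  have hK : 0 ≤ K := (norm_nonneg _).trans (hA 0 (by simpa using ha)).2
  have hbig : ∀ t : ℝ, ω < t → ‖resolvent (generator T) (t : ℂ)‖ ≤ M / (t - ω) := by
    intro t ht
    refine ContinuousLinearMap.opNorm_le_bound _ (div_nonneg (by linarith) (by linarith))
      fun x => ?_
    have htre : ω < (t : ℂ).re := by simpa using ht
    rw [← hT.integral_laplace hM htre (hA _ (by simp; linarith)).1 x]
    have h1 : ∫ s in Ioi (0 : ℝ), M * ‖x‖ * Real.exp (-(t - ω) * s) = M / (t - ω) * ‖x‖ := by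
      rw [integral_const_mul, integral_exp_mul_Ioi (by linarith)]
      have : t - ω ≠ 0 := by linarith
      simp only [mul_zero, Real.exp_zero]
      field_simp
    rw [← h1]
    refine norm_integral_le_of_norm_le ((exp_neg_integrableOn_Ioi 0 (sub_pos.2 ht)).const_mul _) ?_
    filter_upwards [self_mem_ae_restrict measurableSet_Ioi] with s hs
    simpa using IsC0Semigroup.norm_cexp_smul_orbit_le hM (t : ℂ) x (le_of_lt hs)
  refine ⟨K * (1 + 2 * ω) + 3 * M, by nlinarith, fun t ht => ?_⟩
  rw [le_div_iff₀ (by linarith)]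
  by_cases h : t ≤ 2 * ω
  · have := (hA (t : ℂ) (by simp; linarith)).2
    nlinarith [norm_nonneg (resolvent (generator T) (t : ℂ))]
  · push Not at h
    have h1 := hbig t (by linarith)
    calc ‖resolvent (generator T) (t : ℂ)‖ * (1 + t) ≤ M / (t - ω) * (3 * (t - ω)) := by
          have : 0 ≤ M / (t - ω) := div_nonneg (by linarith) (by linarith)
          gcongr
          linarith
      _ = 3 * M := by
          have : t - ω ≠ 0 := by linarith
          field_simp
      _ ≤ K * (1 + 2 * ω) + 3 * M := by nlinarith

end Semigroup

/-! ### Convolutions of orbits with exponentials. -/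

/-- The convolution `t ↦ ∫₀ᵗ e^{-l (t - s)} T(s) x ds` of an exponential with an orbit. -/
noncomputable def expConv {X : Type*} [NormedAddCommGroup X] [NormedSpace ℂ X]
    (T : ℝ → X →L[ℂ] X) (l : ℝ) (x : X) (t : ℝ) : X :=
  Complex.exp (-l * t) • ∫ s in (0 : ℝ)..t, Complex.exp (l * s) • T s x

section ExpConv

variable {X : Type*} [NormedAddCommGroup X] [NormedSpace ℂ X] {T : ℝ → X →L[ℂ] X}

theorem expConv_zero (l : ℝ) (x : X) : expConv T l x 0 = 0 := by simp [expConv]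

theorem continuousOn_expConv (hT : IsC0Semigroup T) (l : ℝ) (x : X) :
    ContinuousOn (expConv T l x) (Ici 0) := by
  have h1 : Continuous fun t : ℝ => Complex.exp (-l * t) •
      ∫ s in (0 : ℝ)..t, Complex.exp (l * s) • T (max s 0) x := by
    refine Continuous.smul (by fun_prop) ?_
    have : Continuous fun s : ℝ => Complex.exp (l * s) • T (max s 0) x :=
      Continuous.smul (by fun_prop) (hT.continuous_orbit_max x)
    exact intervalIntegral.continuous_primitive (fun a b => this.intervalIntegrable a b) 0
  refine h1.continuousOn.congr fun t ht => ?_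
  have ht : 0 ≤ t := ht
  rw [expConv]
  congr 1
  refine intervalIntegral.integral_congr fun s hs => ?_
  rw [uIcc_of_le ht] at hs
  simp [max_eq_left hs.1]

theorem norm_expConv_le {M ω : ℝ} (hω : 0 ≤ ω)
    (hM : ∀ t : ℝ, 0 ≤ t → ‖T t‖ ≤ M * Real.exp (ω * t)) {l : ℝ} (hl : 0 < l) (x : X) {t : ℝ}
    (ht : 0 ≤ t) : ‖expConv T l x t‖ ≤ M * Real.exp (ω * t) * ‖x‖ / l := by
  have hM0 : 0 ≤ M := by simpa using (norm_nonneg _).trans (hM 0 le_rfl)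
  have h1 : ‖∫ s in (0 : ℝ)..t, Complex.exp (l * s) • T s x‖ ≤
      ∫ s in (0 : ℝ)..t, M * Real.exp (ω * t) * ‖x‖ * Real.exp (l * s) := by
    refine intervalIntegral.norm_integral_le_of_norm_le ht ?_
      (Continuous.intervalIntegrable (by fun_prop) _ _)
    refine Eventually.of_forall fun s hs => ?_
    have hs0 : 0 ≤ s := hs.1.le
    rw [norm_smul, Complex.norm_exp]
    have e : ((l : ℂ) * s).re = l * s := by simp
    rw [e, mul_comm]
    gcongr
    refine ((T s).le_of_opNorm_le (hM s hs0) x).trans ?_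
    gcongr
    exact hs.2
  have h2 : ∫ s in (0 : ℝ)..t, M * Real.exp (ω * t) * ‖x‖ * Real.exp (l * s) =
      M * Real.exp (ω * t) * ‖x‖ * ((Real.exp (l * t) - 1) / l) := by
    rw [intervalIntegral.integral_const_mul, intervalIntegral.integral_comp_mul_left _ hl.ne',
      integral_exp]
    simp [div_eq_inv_mul]
  rw [h2] at h1
  have e : ((-l : ℂ) * t).re = -l * t := by simp
  rw [expConv, norm_smul, Complex.norm_exp, e]
  calc Real.exp (-l * t) * ‖∫ s in (0 : ℝ)..t, Complex.exp (l * s) • T s x‖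
      ≤ Real.exp (-l * t) * (M * Real.exp (ω * t) * ‖x‖ * (Real.exp (l * t) / l)) := by
        gcongr
        refine h1.trans ?_
        gcongr
        linarith
    _ = Real.exp (-l * t) * Real.exp (l * t) * (M * Real.exp (ω * t) * ‖x‖ / l) := by ring
    _ = M * Real.exp (ω * t) * ‖x‖ / l := by
        rw [← Real.exp_add]; simp

/-- Split the integral at `s` and pull `T s` out of the part over `[s, t + s]`. This carries a bound
at one time to later times, up to an exponentially damped remainder. -/
theorem expConv_add [CompleteSpace X] (hT : IsC0Semigroup T) (l : ℝ) (x : X) {s t : ℝ} (hs : 0 ≤ s)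
    (ht : 0 ≤ t) :
    expConv T l x (t + s) = T s (expConv T l x t) + Complex.exp (-l * t) • expConv T l x s := by
  have h1 : ∫ r in s..(t + s), Complex.exp (l * r) • T r x =
      Complex.exp (l * s) • T s (∫ r in (0 : ℝ)..t, Complex.exp (l * r) • T r x) := by
    rw [← ContinuousLinearMap.intervalIntegral_comp_comm _
      (hT.intervalIntegrable_cexp_smul_orbit l x le_rfl ht), ← intervalIntegral.integral_smul]
    nth_rewrite 1 [← zero_add s]
    rw [← intervalIntegral.integral_comp_add_right (fun r => Complex.exp (l * r) • T r x)]
    refine intervalIntegral.integral_congr fun r hr => ?_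
    rw [uIcc_of_le ht] at hr
    rw [add_comm r s, hT.map_add s r hs hr.1, map_smul, smul_smul, ContinuousLinearMap.comp_apply,
      ← Complex.exp_add]
    push_cast
    congr 2
    ring
  rw [expConv, expConv, expConv, ← intervalIntegral.integral_add_adjacent_intervals
    (hT.intervalIntegrable_cexp_smul_orbit l x le_rfl hs)
    (hT.intervalIntegrable_cexp_smul_orbit l x hs (by positivity : 0 ≤ t + s)), h1, smul_add,
    map_smul, smul_smul, smul_smul, ← Complex.exp_add, ← Complex.exp_add, add_comm]
  push_cast
  congr 3 <;> ring_nf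

theorem expConv_of_mem_graph [CompleteSpace X] (hT : IsC0Semigroup T) {v y : X}
    (h : (v, y) ∈ (generator T).graph) (l : ℝ) {t : ℝ} (ht : 0 ≤ t) :
    expConv T l ((l : ℂ) • v + y) t = T t v - Complex.exp (-l * t) • v := by
  rw [expConv, hT.integral_cexp_smul_orbit h l ht, smul_sub, smul_smul, ← Complex.exp_add]
  simp

/-- For `v = R(l)x` one has `lv + Av = 2lR(l)x - x`, so decay of `expConv` on all of `X` transfers
to `T(t)R(l)`. -/
theorem orbit_resolvent_eq [CompleteSpace X] (hT : IsC0Semigroup T) {l : ℝ}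
    (hl : (l : ℂ) ∈ resolventSet (generator T)) (x : X) {t : ℝ} (ht : 0 ≤ t) :
    T t (resolvent (generator T) l x) =
      expConv T l ((2 * l : ℂ) • resolvent (generator T) l x - x) t +
        Complex.exp (-l * t) • resolvent (generator T) l x := by
  have h := expConv_of_mem_graph hT (resolvent_mem_graph hl x) l ht
  have e : (l : ℂ) • resolvent (generator T) l x + ((l : ℂ) • resolvent (generator T) l x - x) =
      (2 * l : ℂ) • resolvent (generator T) l x - x := by
    rw [two_mul, add_smul]; abel
  rw [← e, h]; abel

theorem integrableOn_cexp_smul_expConv (hT : IsC0Semigroup T) {M ω : ℝ} (hω : 0 ≤ ω)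
    (hM : ∀ t : ℝ, 0 ≤ t → ‖T t‖ ≤ M * Real.exp (ω * t)) {z : ℂ} (hz : ω < z.re) {l : ℝ}
    (hl : 0 < l) (x : X) :
    IntegrableOn (fun t : ℝ => Complex.exp (-z * t) • expConv T l x t) (Ioi 0) := by
  have h1 : IntegrableOn (fun t : ℝ => M * ‖x‖ / l * Real.exp (-(z.re - ω) * t)) (Ioi 0) :=
    (exp_neg_integrableOn_Ioi 0 (sub_pos.2 hz)).const_mul _
  refine Integrable.mono' h1 (ContinuousOn.aestronglyMeasurable
    (ContinuousOn.smul (by fun_prop) ((continuousOn_expConv hT l x).mono Ioi_subset_Ici_self))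
      measurableSet_Ioi) ?_
  filter_upwards [self_mem_ae_restrict measurableSet_Ioi] with t ht
  have e : (-z * t).re = -z.re * t := by simp
  rw [norm_smul, Complex.norm_exp, e]
  calc Real.exp (-z.re * t) * ‖expConv T l x t‖
      ≤ Real.exp (-z.re * t) * (M * Real.exp (ω * t) * ‖x‖ / l) := by
        gcongr
        exact norm_expConv_le hω hM hl x (le_of_lt ht)
    _ = M * ‖x‖ / l * Real.exp (-(z.re - ω) * t) := by
        rw [show -(z.re - ω) * t = -z.re * t + ω * t by ring, Real.exp_add]; ring

theorem integral_laplace_expConv [CompleteSpace X] (hT : IsC0Semigroup T) {M ω : ℝ} (hω : 0 ≤ ω)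
    (hM : ∀ t : ℝ, 0 ≤ t → ‖T t‖ ≤ M * Real.exp (ω * t)) {z : ℂ} (hz : ω < z.re)
    (hzρ : z ∈ resolventSet (generator T)) {l : ℝ} (hl : 0 < l) (x : X) :
    ∫ t in Ioi (0 : ℝ), Complex.exp (-z * t) • expConv T l x t =
      (z + l)⁻¹ • resolvent (generator T) z x := by
  have hre : (-(z + l)).re < 0 := by simp; linarith
  have hg : IntegrableOn (fun t : ℝ => Complex.exp (-(z + l) * t)) (Ioi 0) :=
    integrableOn_exp_mul_complex_Ioi hre 0
  have h := integral_posConvolution (hT.integrableOn_cexp_smul_orbit hM hz x) hg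
    (ContinuousLinearMap.lsmul ℝ ℂ).flip
  rw [hT.integral_laplace hM hz hzρ, integral_exp_mul_complex_Ioi hre] at h
  simp only [ContinuousLinearMap.flip_apply, ContinuousLinearMap.lsmul_apply, Complex.ofReal_zero,
    mul_zero, Complex.exp_zero] at h
  have e : -1 / -(z + (l : ℂ)) = (z + l)⁻¹ := by rw [neg_div_neg_eq, one_div]
  rw [e] at h
  rw [← h]
  congr 1
  ext t
  rw [expConv, smul_smul, ← intervalIntegral.integral_smul]
  congr 1
  ext s
  rw [smul_smul, smul_smul, ← Complex.exp_add, ← Complex.exp_add, ← Complex.exp_add]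
  push_cast
  congr 2
  ring

/-- The kernels `l e^{-lu}` form an approximate identity; after substituting `u = l(t - s)`,
dominated convergence applies. -/
theorem tendsto_smul_expConv [CompleteSpace X] (hT : IsC0Semigroup T) (x : X) {t : ℝ} (ht : 0 < t) :
    Tendsto (fun l : ℝ => l • expConv T l x t) atTop (𝓝 (T t x)) := by
  set g : ℝ → X := fun s => T (max s 0) x with hg
  have hgc : Continuous g := hT.continuous_orbit_max x
  obtain ⟨C, hC⟩ := isCompact_Icc.exists_bound_of_continuousOn (hgc.continuousOn (s := Icc 0 t))
  have h1 : ∀ l : ℝ, 0 < l → l • expConv T l x t =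
      ∫ u in Ioi (0 : ℝ), (Iic (l * t)).indicator (fun u => Real.exp (-u) • g (t - u / l)) u := by
    intro l hl
    rw [setIntegral_indicator measurableSet_Iic, Ioi_inter_Iic,
      ← intervalIntegral.integral_of_le (by positivity)]
    have h2 := intervalIntegral.integral_comp_mul_left (a := 0) (b := t)
      (fun u => Real.exp (-u) • g (t - u / l)) hl.ne'
    rw [mul_zero] at h2
    rw [eq_inv_smul_iff₀ hl.ne'] at h2
    rw [← h2]
    have h3 := intervalIntegral.integral_comp_sub_left (a := 0) (b := t)
      (fun s => Real.exp (-(l * (t - s))) • g s) t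
    rw [sub_self, sub_zero] at h3
    congr 1
    have h4 : ∫ s in (0 : ℝ)..t, Real.exp (-(l * s)) • g (t - l * s / l) =
        ∫ s in (0 : ℝ)..t, Real.exp (-(l * (t - (t - s)))) • g (t - s) := by
      congr 1
      ext s
      rw [sub_sub_cancel, mul_div_cancel_left₀ _ hl.ne']
    rw [h4, h3, expConv, ← intervalIntegral.integral_smul]
    refine intervalIntegral.integral_congr fun s hs => ?_
    rw [uIcc_of_le ht.le] at hs
    simp only [hg, max_eq_left hs.1]
    rw [smul_smul, ← Complex.exp_add, ← Complex.coe_smul]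
    push_cast
    congr 2
    ring
  have h2 : Tendsto (fun l : ℝ => ∫ u in Ioi (0 : ℝ),
      (Iic (l * t)).indicator (fun u => Real.exp (-u) • g (t - u / l)) u) atTop
      (𝓝 (∫ u in Ioi (0 : ℝ), Real.exp (-u) • T t x)) := by
    refine tendsto_integral_filter_of_dominated_convergence (fun u => Real.exp (-u) * C) ?_ ?_ ?_ ?_
    · exact Eventually.of_forall fun l => (Continuous.aestronglyMeasurable
        (by fun_prop)).indicator measurableSet_Iic
    · filter_upwards [eventually_gt_atTop 0] with l hl
      filter_upwards [self_mem_ae_restrict measurableSet_Ioi] with u hu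
      have hu : 0 < u := hu
      have hC0 : 0 ≤ C := (norm_nonneg _).trans (hC 0 ⟨le_rfl, ht.le⟩)
      by_cases h : u ∈ Iic (l * t)
      · rw [indicator_of_mem h, norm_smul, Real.norm_of_nonneg (Real.exp_pos _).le]
        gcongr
        refine hC _ ⟨?_, ?_⟩
        · rw [sub_nonneg, div_le_iff₀ hl, mul_comm]; exact h
        · have : 0 ≤ u / l := by positivity
          linarith
      · rw [indicator_of_notMem h, norm_zero]; positivity
    · have : IntegrableOn (fun u : ℝ => Real.exp (-u)) (Ioi 0) := integrableOn_exp_neg_Ioi 0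
      exact this.mul_const C
    · filter_upwards [self_mem_ae_restrict measurableSet_Ioi] with u hu
      have h3 : Tendsto (fun l : ℝ => Real.exp (-u) • g (t - u / l)) atTop
          (𝓝 (Real.exp (-u) • g (t - 0))) :=
        ((hgc.tendsto _).comp (tendsto_const_nhds.sub
          (tendsto_const_nhds.div_atTop tendsto_id))).const_smul _
      have e : g (t - 0) = T t x := by simp [hg, max_eq_left ht.le]
      rw [e] at h3
      refine h3.congr' ?_
      filter_upwards [(tendsto_id.atTop_mul_const ht).eventually_ge_atTop u] with l hl
      rw [indicator_of_mem]
      exact hl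
  rw [integral_smul_const, integral_exp_neg_Ioi_zero, one_smul] at h2
  refine h2.congr' ?_
  filter_upwards [eventually_gt_atTop 0] with l hl using (h1 l hl).symm

end ExpConv

/-! ### Reduction of Fourier type to dimension one. -/

section FourierType

variable {X : Type*} [NormedAddCommGroup X] [NormedSpace ℂ X]

/-- The Gaussian `e^{-π ‖v‖²}`, which is its own Fourier transform. -/
noncomputable def gaussian (V : Type*) [NormedAddCommGroup V] (v : V) : ℂ :=
  Complex.exp (-(Real.pi : ℂ) * (‖v‖ : ℂ) ^ 2)

section Gaussian

variable {V : Type*} [NormedAddCommGroup V] [InnerProductSpace ℝ V] [FiniteDimensional ℝ V]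
  [MeasurableSpace V] [BorelSpace V]

theorem fourier_gaussian (w : V) : 𝓕 (gaussian V) w = gaussian V w := by
  have h := fourier_gaussian_innerProductSpace (V := V) (b := Real.pi)
    (by simpa using Real.pi_pos) w
  have hpi : (Real.pi : ℂ) ≠ 0 := by exact_mod_cast Real.pi_ne_zero
  rw [div_self hpi, Complex.one_cpow, one_mul] at h
  refine h.trans ?_
  rw [gaussian]
  congr 1
  field_simp

theorem memLp_gaussian {q : ℝ≥0∞} (hq0 : q ≠ 0) (hq : q ≠ ∞) : MemLp (gaussian V) q volume := by
  have hq' : 0 < q.toReal := ENNReal.toReal_pos hq0 hq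
  have hc : Continuous (gaussian V) := by unfold gaussian; fun_prop
  rw [← integrable_norm_rpow_iff hc.aestronglyMeasurable hq0 hq]
  have h := (GaussianFourier.integrable_cexp_neg_mul_sq_norm_add (V := V)
    (b := (q.toReal * Real.pi : ℝ)) (by simp only [Complex.ofReal_re]; positivity) 0 0).norm
  refine h.congr (Eventually.of_forall fun v => ?_)
  simp only [gaussian, Complex.norm_exp]
  rw [← Real.exp_mul]
  congr 1
  simp [← Complex.ofReal_pow]
  ring

theorem eLpNorm_gaussian_ne_zero {q : ℝ≥0∞} (hq0 : q ≠ 0) :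
    eLpNorm (gaussian V) q volume ≠ 0 := by
  have hc : Continuous (gaussian V) := by unfold gaussian; fun_prop
  rw [Ne, eLpNorm_eq_zero_iff hc.aestronglyMeasurable hq0]
  intro h
  have : (volume : Measure V) = 0 := by
    rw [← ae_eq_bot, ← Filter.eventually_false_iff_eq_bot]
    filter_upwards [h] with v hv
    exact Complex.exp_ne_zero _ hv
  exact (NeZero.ne (volume : Measure V)) this

end Gaussian

theorem eLpNorm_smul_prod {α β : Type*} [MeasurableSpace α] [MeasurableSpace β] {μ : Measure α}
    {ν : Measure β} [SFinite μ] [SFinite ν] {q : ℝ≥0∞} (hq0 : q ≠ 0) (hq : q ≠ ∞) {f : α → ℂ}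
    {g : β → X} (hf : AEStronglyMeasurable f μ) (hg : AEStronglyMeasurable g ν) :
    eLpNorm (fun z : α × β => f z.1 • g z.2) q (μ.prod ν) = eLpNorm f q μ * eLpNorm g q ν := by
  rw [eLpNorm_eq_lintegral_rpow_enorm_toReal hq0 hq, eLpNorm_eq_lintegral_rpow_enorm_toReal hq0 hq,
    eLpNorm_eq_lintegral_rpow_enorm_toReal hq0 hq, ← ENNReal.mul_rpow_of_nonneg _ _ (by positivity)]
  congr 1
  rw [← lintegral_prod_mul (hf.enorm.pow_const _) (hg.enorm.pow_const _)]
  simp_rw [enorm_smul, ENNReal.mul_rpow_of_nonneg _ _ ENNReal.toReal_nonneg]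

theorem fourier_smul_prod {V : Type*} [NormedAddCommGroup V] [InnerProductSpace ℝ V]
    [FiniteDimensional ℝ V] [MeasurableSpace V] [BorelSpace V] (f : V → ℂ) (g : ℝ → X)
    (w : WithLp 2 (V × ℝ)) :
    𝓕 (fun z : WithLp 2 (V × ℝ) => f z.fst • g z.snd) w = 𝓕 f w.fst • 𝓕 g w.snd := by
  rw [Real.fourier_eq', Real.fourier_eq', Real.fourier_eq',
    ← (WithLp.volume_preserving_toLp V ℝ).integral_comp
      (MeasurableEquiv.toLp 2 (V × ℝ)).measurableEmbedding]
  rw [← integral_prod_smul, ← Measure.volume_eq_prod]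
  congr 1
  ext z
  simp only [WithLp.prod_inner_apply, WithLp.toLp_fst, WithLp.toLp_snd]
  rw [smul_eq_mul, smul_smul, smul_smul]
  congr 1
  rw [mul_right_comm (Complex.exp _) (f z.1), ← Complex.exp_add]
  congr 2
  push_cast
  simp
  ring

theorem eLpNorm_smul_withLp_prod {V : Type*} [NormedAddCommGroup V] [InnerProductSpace ℝ V]
    [FiniteDimensional ℝ V] [MeasurableSpace V] [BorelSpace V] {q : ℝ≥0∞} (hq0 : q ≠ 0)
    (hq : q ≠ ∞) {f : V → ℂ} {g : ℝ → X} (hf : AEStronglyMeasurable f volume)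
    (hg : AEStronglyMeasurable g volume) :
    eLpNorm (fun z : WithLp 2 (V × ℝ) => f z.fst • g z.snd) q volume =
      eLpNorm f q volume * eLpNorm g q volume := by
  have hm : MeasurableEmbedding (WithLp.toLp 2 : V × ℝ → WithLp 2 (V × ℝ)) :=
    (MeasurableEquiv.toLp 2 (V × ℝ)).measurableEmbedding
  rw [← eLpNorm_smul_prod hq0 hq hf hg, ← (WithLp.volume_preserving_toLp V ℝ).map_eq,
    hm.eLpNorm_map_measure]
  rfl

/-- Fourier type with respect to the real line. -/
theorem HasFourierType.real {n : ℕ} (hn : 1 ≤ n) {p : ℝ≥0∞} (hp1 : 1 ≤ p) (hp2 : p ≤ 2)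
    (hX : HasFourierType n X p) :
    ∃ C : ℝ≥0, ∀ f : ℝ → X, Integrable f volume → MemLp f p volume →
      eLpNorm (𝓕 f) (ENNReal.conjExponent p) volume ≤ C * eLpNorm f p volume := by
  rcases hp1.eq_or_lt with rfl | hp1'
  -- For `p = 1` the target exponent is `∞`, which `eLpNorm_smul_prod` excludes; here the trivial
  -- bound by the `L¹` norm suffices.
  · refine ⟨1, fun f hf _ => ?_⟩
    have h1 : ENNReal.conjExponent 1 = ∞ := by simp [ENNReal.conjExponent]
    rw [h1, eLpNorm_exponent_top, ENNReal.coe_one, one_mul]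
    refine eLpNormEssSup_le_of_ae_enorm_bound (Eventually.of_forall fun x => ?_)
    rw [eLpNorm_one_eq_lintegral_enorm, Real.fourier_eq]
    refine (enorm_integral_le_lintegral_enorm _).trans (lintegral_mono fun v => ?_)
    rw [enorm_eq_nnnorm, enorm_eq_nnnorm]
    simp [← NNReal.coe_le_coe]
  obtain ⟨m, rfl⟩ : ∃ m, n = m + 1 := ⟨n - 1, by omega⟩
  obtain ⟨C, hC⟩ := hX
  set q := ENNReal.conjExponent p with hq
  have hp0 : p ≠ 0 := (zero_lt_one.trans_le hp1).ne'
  have hpt : p ≠ ∞ := (hp2.trans_lt (by simp)).ne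
  have hq0 : q ≠ 0 := by rw [hq, ENNReal.conjExponent]; positivity
  have hqt : q ≠ ∞ := by
    rw [hq, ENNReal.conjExponent]
    simp [ENNReal.add_eq_top, tsub_eq_zero_iff_le, hp1']
  set V := EuclideanSpace ℝ (Fin m) with hV
  set W := WithLp 2 (V × ℝ) with hW
  have hfr : Module.finrank ℝ W = m + 1 := by
    rw [(WithLp.linearEquiv 2 ℝ (V × ℝ)).finrank_eq, Module.finrank_prod,
      show Module.finrank ℝ V = m from finrank_euclideanSpace_fin, Module.finrank_self]
  let e : EuclideanSpace ℝ (Fin (m + 1)) ≃ₗᵢ[ℝ] W :=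
    ((stdOrthonormalBasis ℝ W).reindex (finCongr hfr)).repr.symm
  set γ := gaussian V with hγ
  have hγp : MemLp γ p volume := memLp_gaussian hp0 hpt
  have hγq : MemLp γ q volume := memLp_gaussian hq0 hqt
  have hγ1 : Integrable γ volume := memLp_one_iff_integrable.1 (memLp_gaussian (by simp) (by simp))
  -- The hypothesis is tested on `γ ⊗ f`. Both norms factor and `γ` is its own transform, so
  -- division by the `L^q` norm of `γ` leaves the inequality for `f`.
  refine ⟨C * (eLpNorm γ p volume).toNNReal / (eLpNorm γ q volume).toNNReal, fun f hf hfp => ?_⟩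
  set F : W → X := fun z => γ z.fst • f z.snd with hF
  have hFm : AEStronglyMeasurable F volume := by
    have := (WithLp.volume_preserving_ofLp V ℝ)
    exact (hγ1.1.comp_fst.smul hf.1.comp_snd).comp_measurePreserving this
  have hFp : eLpNorm F p volume = eLpNorm γ p volume * eLpNorm f p volume :=
    eLpNorm_smul_withLp_prod hp0 hpt hγ1.1 hf.1
  have hF1 : eLpNorm F 1 volume = eLpNorm γ 1 volume * eLpNorm f 1 volume :=
    eLpNorm_smul_withLp_prod (by simp) (by simp) hγ1.1 hf.1
  have hFp' : MemLp F p volume :=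
    ⟨hFm, by rw [hFp]; exact ENNReal.mul_lt_top hγp.2 hfp.2⟩
  have hF1' : MemLp F 1 volume :=
    ⟨hFm, by
      rw [hF1]
      exact ENNReal.mul_lt_top (memLp_one_iff_integrable.2 hγ1).2
        (memLp_one_iff_integrable.2 hf).2⟩
  have hem := e.measurePreserving
  have hFe := hC (F ∘ e) (memLp_one_iff_integrable.1 (hF1'.comp_measurePreserving hem))
    (hFp'.comp_measurePreserving hem)
  have hff : 𝓕 F = fun z => 𝓕 γ z.fst • 𝓕 f z.snd := funext fun w => fourier_smul_prod γ f w
  have hfγ : 𝓕 γ = γ := funext fourier_gaussian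
  have hFc : Continuous (𝓕 f) := by
    exact VectorFourier.fourierIntegral_continuous Real.continuous_fourierChar
      (by exact continuous_inner) hf
  have hFq : eLpNorm (𝓕 F) q volume = eLpNorm γ q volume * eLpNorm (𝓕 f) q volume := by
    rw [hff, hfγ]
    exact eLpNorm_smul_withLp_prod hq0 hqt hγ1.1 hFc.aestronglyMeasurable
  have hFem : AEStronglyMeasurable (𝓕 F) volume := by
    rw [hff, hfγ]
    exact (hγ1.1.comp_fst.smul hFc.aestronglyMeasurable.comp_snd).comp_measurePreserving
      (WithLp.volume_preserving_ofLp V ℝ)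
  have hcomp : 𝓕 (F ∘ e) = 𝓕 F ∘ e := funext fun w => Real.fourier_comp_linearIsometry e F w
  rw [hcomp, eLpNorm_comp_measurePreserving hFem hem, eLpNorm_comp_measurePreserving hFm hem,
    hFq, hFp] at hFe
  have hγ0 : eLpNorm γ q volume ≠ 0 := eLpNorm_gaussian_ne_zero hq0
  have hγ0' : (eLpNorm γ q volume).toNNReal ≠ 0 := by
    simp [ENNReal.toNNReal_eq_zero_iff, hγ0, hγq.2.ne]
  rw [ENNReal.coe_div hγ0', ENNReal.coe_mul, ENNReal.coe_toNNReal hγp.2.ne,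
    ENNReal.coe_toNNReal hγq.2.ne, ← ENNReal.mul_div_right_comm,
    ENNReal.le_div_iff_mul_le (Or.inl hγ0) (Or.inl hγq.2.ne), mul_comm]
  rwa [mul_assoc]

end FourierType

/-! ### Contour shift and Fourier inversion on vertical lines. -/

section Contour

variable {X : Type*} [NormedAddCommGroup X] [NormedSpace ℂ X]

/-- Shifting a vertical line of integration. -/
theorem integral_vertical_eq [CompleteSpace X] {F : ℂ → X} {b σ K : ℝ} (hbσ : b ≤ σ)
    (hd : ∀ z : ℂ, b ≤ z.re → z.re ≤ σ → DifferentiableAt ℂ F z)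
    (hK : ∀ z : ℂ, b ≤ z.re → z.re ≤ σ → ‖F z‖ ≤ K / (1 + z.im ^ 2)) :
    ∫ s : ℝ, F (b + s * Complex.I) = ∫ s : ℝ, F (σ + s * Complex.I) := by
  have hint : ∀ c : ℝ, b ≤ c → c ≤ σ → Integrable fun s : ℝ => F (c + s * Complex.I) := by
    intro c hbc hcσ
    refine Integrable.mono' (integrable_inv_one_add_sq.const_mul K)
      (Continuous.aestronglyMeasurable ?_) (Eventually.of_forall fun s => ?_)
    · rw [continuous_iff_continuousAt]
      intro s
      exact ContinuousAt.comp (g := F) (hd _ (by simpa using hbc) (by simpa using hcσ)).continuousAt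
        (Continuous.continuousAt (by fun_prop))
    · simpa [div_eq_mul_inv] using hK (c + s * Complex.I) (by simpa using hbc) (by simpa using hcσ)
  have hlim : ∀ c : ℝ, b ≤ c → c ≤ σ → Tendsto
      (fun N : ℝ => ∫ s in (-N)..N, F (c + s * Complex.I)) atTop
      (𝓝 (∫ s : ℝ, F (c + s * Complex.I))) := fun c h1 h2 =>
    intervalIntegral_tendsto_integral (hint c h1 h2) tendsto_neg_atTop_atBot tendsto_id
  have hedge : ∀ r : ℝ → ℝ, (∀ N, r N ^ 2 = N ^ 2) → Tendsto
      (fun N : ℝ => ∫ x in b..σ, F (x + r N * Complex.I)) atTop (𝓝 0) := by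
    intro r hr
    have h1 : Tendsto (fun N : ℝ => K / (1 + N ^ 2) * |σ - b|) atTop (𝓝 0) := by
      have h2 : Tendsto (fun N : ℝ => 1 + N ^ 2) atTop atTop :=
        tendsto_atTop_add_const_left _ _ (tendsto_pow_atTop two_ne_zero)
      simpa using (tendsto_const_nhds (x := K).div_atTop h2).mul_const |σ - b|
    refine squeeze_zero_norm (fun N => ?_) h1
    refine intervalIntegral.norm_integral_le_of_norm_le_const fun x hx => ?_
    rw [uIoc_of_le hbσ] at hx
    have := hK (x + r N * Complex.I) (by simpa using hx.1.le) (by simpa using hx.2)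
    simpa [hr] using this
  have hrect : ∀ N : ℝ, 0 ≤ N → (∫ x in b..σ, F (x + (-N : ℝ) * Complex.I)) -
      (∫ x in b..σ, F (x + N * Complex.I)) + Complex.I • (∫ s in (-N)..N, F (σ + s * Complex.I)) -
      Complex.I • (∫ s in (-N)..N, F (b + s * Complex.I)) = 0 := by
    intro N hN
    have h := Complex.integral_boundary_rect_eq_zero_of_differentiableOn F
      (b + (-N : ℝ) * Complex.I) (σ + N * Complex.I) (fun z hz => by
        refine (hd z ?_ ?_).differentiableWithinAt
        · have := hz.1; simp [uIcc_of_le hbσ] at this; exact this.1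
        · have := hz.1; simp [uIcc_of_le hbσ] at this; exact this.2)
    simpa using h
  have hfin := (((hedge (fun N => -N) (fun N => by ring)).sub (hedge (fun N => N) fun N => rfl)).add
    ((hlim σ hbσ le_rfl).const_smul Complex.I)).sub ((hlim b le_rfl hbσ).const_smul Complex.I)
  have h0 := tendsto_nhds_unique (hfin.congr' (f₂ := fun _ => (0 : X)) (by
    filter_upwards [eventually_ge_atTop 0] with N hN using hrect N hN)) tendsto_const_nhds
  rw [sub_zero, zero_add, ← smul_sub, smul_eq_zero] at h0
  exact (sub_eq_zero.1 (h0.resolve_left Complex.I_ne_zero)).symm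

/-- Both bounds come from `Re z + l ≥ l - 1/2 ≥ l/2 ≥ 1/2`. -/
theorem norm_add_ofReal_ge {z : ℂ} {l : ℝ} (hl : 1 ≤ l) (hz : -(1 / 2) ≤ z.re) :
    l / 2 ≤ ‖z + l‖ ∧ (1 + z.im ^ 2) / 4 ≤ ‖z + l‖ ^ 2 := by
  have hn : ‖z + l‖ ^ 2 = (z.re + l) ^ 2 + z.im ^ 2 := by
    rw [← Complex.normSq_eq_norm_sq, Complex.normSq_apply]; simp; ring
  constructor
  · refine abs_le_of_sq_le_sq' ?_ (norm_nonneg _) |>.2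
    rw [hn]
    nlinarith [sq_nonneg z.im]
  · rw [hn]
    nlinarith [sq_nonneg z.im]

theorem add_ofReal_ne_zero {z : ℂ} {l : ℝ} (hl : 1 ≤ l) (hz : -(1 / 2) ≤ z.re) : z + l ≠ 0 := by
  rw [← norm_pos_iff]
  have := (norm_add_ofReal_ge hl hz).1
  linarith

/-- The difference of the Laplace transforms of `e^{-l t}` and `e^{-m t}`. -/
noncomputable def kernelDiff (l m : ℝ) (z : ℂ) : ℂ := (z + l)⁻¹ - (z + m)⁻¹

/-- The difference is `(m - l) / ((z + l)(z + m))`. Its quadratic decay is what makes the vertical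
integrals converge absolutely. -/
theorem norm_kernelDiff_le {l m : ℝ} (hl : 1 ≤ l) (hm : 1 ≤ m) {z : ℂ} (hz : -(1 / 2) ≤ z.re) :
    ‖kernelDiff l m z‖ ≤ 4 * |m - l| / (1 + z.im ^ 2) := by
  have h1 := (norm_add_ofReal_ge hl hz).2
  have h2 := (norm_add_ofReal_ge hm hz).2
  have hl0 := add_ofReal_ne_zero hl hz
  have hm0 := add_ofReal_ne_zero hm hz
  have e : kernelDiff l m z = ((m - l : ℝ) : ℂ) / ((z + l) * (z + m)) := by
    rw [kernelDiff, inv_sub_inv hl0 hm0]; push_cast; ring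
  have h3 : (1 + z.im ^ 2) / 4 ≤ ‖z + l‖ * ‖z + m‖ := by
    refine abs_le_of_sq_le_sq' ?_ (by positivity) |>.2
    rw [mul_pow, sq]
    gcongr
  rw [e, norm_div, norm_mul, Complex.norm_real, Real.norm_eq_abs]
  calc |m - l| / (‖z + l‖ * ‖z + m‖) ≤ |m - l| / ((1 + z.im ^ 2) / 4) := by gcongr
    _ = 4 * |m - l| / (1 + z.im ^ 2) := by field_simp

theorem differentiableAt_kernelDiff {l m : ℝ} (hl : 1 ≤ l) (hm : 1 ≤ m) {z : ℂ}
    (hz : -(1 / 2) ≤ z.re) : DifferentiableAt ℂ (kernelDiff l m) z := by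
  unfold kernelDiff
  have h : ∀ r : ℝ, DifferentiableAt ℂ (fun w : ℂ => w + r) z := fun r =>
    differentiableAt_id.add_const _
  exact ((h l).inv (add_ofReal_ne_zero hl hz)).sub ((h m).inv (add_ofReal_ne_zero hm hz))

variable {T : ℝ → X →L[ℂ] X}

/-- The transform of `t ↦ e^{ε t} (expConv T l x t - expConv T m x t)`. -/
noncomputable def expConvSymbol (T : ℝ → X →L[ℂ] X) (ε l m : ℝ) (x : X) (s : ℝ) : X :=
  kernelDiff l m (((-ε : ℝ) : ℂ) + ((2 * Real.pi * s : ℝ) : ℂ) * Complex.I) •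
    resolvent (generator T) (((-ε : ℝ) : ℂ) + ((2 * Real.pi * s : ℝ) : ℂ) * Complex.I) x

section

variable {a K : ℝ}
  (hA : ∀ z : ℂ, -a < z.re → z ∈ resolventSet (generator T) ∧ ‖resolvent (generator T) z‖ ≤ K)
include hA

theorem continuous_expConvSymbol {ε l m : ℝ} (hεa : ε < a) (hε : ε ≤ 1 / 2) (hl : 1 ≤ l)
    (hm : 1 ≤ m) (x : X) : Continuous (expConvSymbol T ε l m x) := by
  refine Continuous.smul ?_ ((continuous_resolvent_vertical hA (by linarith) _).clm_apply
    continuous_const)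
  rw [continuous_iff_continuousAt]
  intro s
  refine ContinuousAt.comp (g := kernelDiff l m)
    (differentiableAt_kernelDiff hl hm (by simpa using hε)).continuousAt
    (Continuous.continuousAt (by fun_prop))

theorem integrable_expConvSymbol {ε l m : ℝ} (hεa : ε < a) (hε : ε ≤ 1 / 2) (hl : 1 ≤ l)
    (hm : 1 ≤ m) (x : X) : Integrable (expConvSymbol T ε l m x) := by
  have h1 : Integrable fun s : ℝ => 4 * |m - l| * (K * ‖x‖) * (1 + (2 * Real.pi * s) ^ 2)⁻¹ :=
    (integrable_inv_one_add_sq.comp_mul_left' (by positivity)).const_mul _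
  refine h1.mono' (continuous_expConvSymbol hA hεa hε hl hm x).aestronglyMeasurable
    (Eventually.of_forall fun s => ?_)
  set z : ℂ := ((-ε : ℝ) : ℂ) + ((2 * Real.pi * s : ℝ) : ℂ) * Complex.I with hz
  have hre : z.re = -ε := by simp [hz]
  have him : z.im = 2 * Real.pi * s := by simp [hz]
  have h2 := norm_kernelDiff_le hl hm (z := z) (by linarith)
  have h3 := (resolvent (generator T) z).le_of_opNorm_le (hA z (by linarith)).2 x
  rw [expConvSymbol, ← hz, norm_smul, ← him]
  calc ‖kernelDiff l m z‖ * ‖resolvent (generator T) z x‖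
      ≤ 4 * |m - l| / (1 + z.im ^ 2) * (K * ‖x‖) := by gcongr
    _ = _ := by ring

/-- Parameter `c` of `expConvSymbol` stands for the line `Re z = -c`, hence `-σ` on the right. As `t
≥ 0`, the factor `e^{zt}` is at most `e^{σt}` in the strip. -/
theorem integral_vertical_expConvSymbol [CompleteSpace X] {ε σ l m : ℝ} (hεa : ε < a)
    (hε : ε ≤ 1 / 2) (hεσ : -ε ≤ σ) (hl : 1 ≤ l) (hm : 1 ≤ m) (x : X) {t : ℝ} (ht : 0 ≤ t) :
    Real.exp (-ε * t) • 𝓕⁻ (expConvSymbol T ε l m x) t =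
      Real.exp (σ * t) • 𝓕⁻ (expConvSymbol T (-σ) l m x) t := by
  have hK0 : 0 ≤ K := (norm_nonneg _).trans (hA ((-ε : ℝ) : ℂ) (by simpa using hεa)).2
  set F : ℂ → X := fun z =>
    Complex.exp (z * t) • kernelDiff l m z • resolvent (generator T) z x with hF
  have key : ∀ c : ℝ, Real.exp (-c * t) • 𝓕⁻ (expConvSymbol T c l m x) t =
      |(2 * Real.pi)⁻¹| • ∫ s : ℝ, F (((-c : ℝ) : ℂ) + s * Complex.I) := by
    intro c
    rw [Real.fourierInv_eq', ← Measure.integral_comp_mul_left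
      (fun s : ℝ => F (((-c : ℝ) : ℂ) + s * Complex.I)), ← integral_smul]
    congr 1
    ext s
    rw [hF, expConvSymbol, ← Complex.coe_smul, smul_smul, Complex.ofReal_exp, ← Complex.exp_add]
    simp only
    congr 2
    push_cast
    simp
    ring
  have hσ := key (-σ)
  rw [neg_neg] at hσ
  rw [key ε, hσ]
  congr 1
  refine integral_vertical_eq (K := Real.exp (σ * t) * (4 * |m - l| * (K * ‖x‖))) hεσ ?_ ?_
  · intro z h1 _
    refine DifferentiableAt.smul (by fun_prop) ((differentiableAt_kernelDiff hl hm
      (by linarith)).smul ?_)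
    exact (hasDerivAt_resolvent hA (by linarith)).differentiableAt.clm_apply
      (differentiableAt_const x)
  · intro z h1 h2
    have h3 := norm_kernelDiff_le hl hm (z := z) (by linarith)
    have h4 := (resolvent (generator T) z).le_of_opNorm_le (hA z (by linarith)).2 x
    rw [hF]
    simp only
    rw [norm_smul, norm_smul, Complex.norm_exp]
    have e : (z * t).re = z.re * t := by simp
    rw [e]
    calc Real.exp (z.re * t) * (‖kernelDiff l m z‖ * ‖resolvent (generator T) z x‖)
        ≤ Real.exp (σ * t) * (4 * |m - l| / (1 + z.im ^ 2) * (K * ‖x‖)) := by gcongr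
      _ = _ := by ring

/-- Fourier inversion far to the right. -/
theorem expConv_sub_eq_of_large [CompleteSpace X] (ha : 0 < a) (hT : IsC0Semigroup T) {M ω : ℝ}
    (hω : 0 ≤ ω) (hM : ∀ t : ℝ, 0 ≤ t → ‖T t‖ ≤ M * Real.exp (ω * t)) {σ : ℝ} (hσ : ω < σ) {l m : ℝ}
    (hl : 1 ≤ l) (hm : 1 ≤ m) (x : X) {t : ℝ} (ht : 0 ≤ t) :
    expConv T l x t - expConv T m x t =
      Real.exp (σ * t) • 𝓕⁻ (expConvSymbol T (-σ) l m x) t := by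
  -- Since `expConv` vanishes at 0, `max t 0` extends the function by zero and keeps it continuous,
  -- as pointwise inversion requires.
  set f : ℝ → X := fun t => Complex.exp (-σ * t) •
    (expConv T l x (max t 0) - expConv T m x (max t 0)) with hf
  have hcl : ∀ r : ℝ, Continuous fun t : ℝ => expConv T r x (max t 0) := fun r =>
    (continuousOn_expConv hT r x).comp_continuous (by fun_prop) fun t => le_max_right t 0
  have hfc : Continuous f := Continuous.smul (by fun_prop) ((hcl l).sub (hcl m))
  have hf0 : ∀ t : ℝ, t ∉ Ioi (0 : ℝ) → f t = 0 := by
    intro t ht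
    have : max t 0 = 0 := max_eq_right (not_lt.1 ht)
    simp [hf, this, expConv_zero]
  have hσre : ∀ s : ℝ, ω < ((σ : ℂ) + ((2 * Real.pi * s : ℝ) : ℂ) * Complex.I).re := fun s => by
    simpa using hσ
  have hfI : ∀ z : ℂ, ω < z.re → IntegrableOn (fun t : ℝ => Complex.exp (-z * t) •
      (expConv T l x t - expConv T m x t)) (Ioi 0) := by
    intro z hz
    simp_rw [smul_sub]
    exact (integrableOn_cexp_smul_expConv hT hω hM hz (by linarith) x).sub
      (integrableOn_cexp_smul_expConv hT hω hM hz (by linarith) x)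
  have hfint : Integrable f := by
    rw [← integrableOn_iff_integrable_of_support_subset (s := Ioi (0 : ℝ))
      (fun t ht => by_contra fun h => ht (hf0 t h))]
    refine (hfI σ (by simpa using hσ)).congr_fun (fun t ht => ?_) measurableSet_Ioi
    simp [hf, max_eq_left (mem_Ioi.1 ht).le]
  have hFf : 𝓕 f = expConvSymbol T (-σ) l m x := by
    ext s
    set z : ℂ := (σ : ℂ) + ((2 * Real.pi * s : ℝ) : ℂ) * Complex.I with hz
    have hzr : ω < z.re := hσre s
    have hzρ := (hA z (by linarith)).1
    rw [Real.fourier_real_eq_integral_exp_smul, expConvSymbol, neg_neg, ← hz, kernelDiff, sub_smul,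
      ← integral_laplace_expConv hT hω hM hzr hzρ (by linarith) x,
      ← integral_laplace_expConv hT hω hM hzr hzρ (by linarith) x,
      ← integral_sub (integrableOn_cexp_smul_expConv hT hω hM hzr (by linarith) x)
      (integrableOn_cexp_smul_expConv hT hω hM hzr (by linarith) x)]
    rw [← setIntegral_eq_integral_of_forall_compl_eq_zero (s := Ioi (0 : ℝ))
      (fun t ht => by rw [hf0 t ht, smul_zero])]
    refine setIntegral_congr_fun measurableSet_Ioi fun t ht => ?_
    simp only [hf, max_eq_left (mem_Ioi.1 ht).le]
    rw [smul_smul, ← Complex.exp_add, ← smul_sub, hz]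
    congr 2
    push_cast
    ring
  have hinv := congrFun (hfc.fourierInv_fourier_eq hfint (by
    rw [hFf]
    exact integrable_expConvSymbol hA (by linarith) (by linarith) hl hm x)) t
  rw [hFf] at hinv
  rw [hinv, hf]
  simp only [max_eq_left ht]
  rw [← Complex.coe_smul, smul_smul, Complex.ofReal_exp, ← Complex.exp_add]
  simp

theorem expConv_sub_eq [CompleteSpace X] (hT : IsC0Semigroup T) {ε l m : ℝ} (hε0 : 0 ≤ ε)
    (hεa : ε < a) (hε : ε ≤ 1 / 2) (hl : 1 ≤ l) (hm : 1 ≤ m) (x : X) {t : ℝ} (ht : 0 ≤ t) :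
    expConv T l x t - expConv T m x t =
      Real.exp (-ε * t) • 𝓕⁻ (expConvSymbol T ε l m x) t := by
  obtain ⟨M, ω, -, hω, hM⟩ := hT.exists_growth_bound
  rw [expConv_sub_eq_of_large hA (by linarith) hT (by linarith) hM (lt_add_one ω) hl hm x ht,
    integral_vertical_expConvSymbol hA hεa hε (σ := ω + 1) (by linarith) hl hm x ht]

end

end Contour

/-! ### Two applications of Fourier type, and the passage to pointwise bounds. -/

section MainEstimate

variable {X : Type*} [NormedAddCommGroup X] [NormedSpace ℂ X]

theorem memLp_indicator_exp_neg {q : ℝ≥0∞} (hq0 : q ≠ 0) (hq : q ≠ ∞) :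
    MemLp ((Ioi (0 : ℝ)).indicator fun t => Real.exp (-t)) q volume := by
  have hq' : 0 < q.toReal := ENNReal.toReal_pos hq0 hq
  rw [memLp_indicator_iff_restrict measurableSet_Ioi, ← integrable_norm_rpow_iff
    (Continuous.aestronglyMeasurable (by fun_prop)) hq0 hq]
  have h := exp_neg_integrableOn_Ioi 0 hq'
  refine h.congr (Eventually.of_forall fun t => ?_)
  simp only [Real.norm_eq_abs, Real.abs_exp]
  rw [← Real.exp_mul]
  congr 1
  ring

variable {T : ℝ → X →L[ℂ] X} {a K : ℝ}
  (hA : ∀ z : ℂ, -a < z.re → z ∈ resolventSet (generator T) ∧ ‖resolvent (generator T) z‖ ≤ K)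
  {p q : ℝ≥0∞} {C : ℝ≥0} (hC : ∀ f : ℝ → X, Integrable f volume → MemLp f p volume →
      eLpNorm (𝓕 f) q volume ≤ C * eLpNorm f p volume)

include hA hC in
/-- Under Fourier type `p`, orbits of the resolvent on vertical lines are in `L^{p'}`. -/
theorem exists_eLpNorm_resolvent_vertical_le [CompleteSpace X] (hp0 : p ≠ 0) (hp : p ≠ ∞)
    (hT : IsC0Semigroup T) {ε : ℝ} (hε0 : 0 ≤ ε) (hεa : ε < a) :
    ∃ D : ℝ≥0, ∀ x : X, eLpNorm (fun s : ℝ => resolvent (generator T)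
      (((-ε : ℝ) : ℂ) + ((2 * Real.pi * s : ℝ) : ℂ) * Complex.I) x) q volume ≤ D * ‖x‖ₑ := by
  obtain ⟨M, ω, hM1, hω1, hM⟩ := hT.exists_growth_bound
  have hK0 : 0 ≤ K := (norm_nonneg _).trans (hA ((-ε : ℝ) : ℂ) (by simpa using hεa)).2
  set g : ℝ → ℝ := (Ioi (0 : ℝ)).indicator fun t => Real.exp (-t) with hg
  have hgp : MemLp g p volume := memLp_indicator_exp_neg hp0 hp
  -- With this shift the damped orbit is dominated by `M‖x‖e^{-t}`, so it lies in `Lᵖ`.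
  set σ : ℝ := ω + 1 with hσ
  refine ⟨(1 + (σ + ε) * K).toNNReal * (C * (M.toNNReal * (eLpNorm g p volume).toNNReal)),
    fun x => ?_⟩
  set f : ℝ → X := (Ioi (0 : ℝ)).indicator fun t => Complex.exp (-σ * t) • T t x with hf
  have hfI : Integrable f := by
    have := hT.integrableOn_cexp_smul_orbit hM (z := (σ : ℂ)) (by simp [hσ]) x
    exact this.integrable_indicator measurableSet_Ioi
  have hfg : ∀ t, ‖f t‖ ≤ M * ‖x‖ * ‖g t‖ := by
    intro t
    by_cases ht : t ∈ Ioi (0 : ℝ)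
    · rw [hf, hg, indicator_of_mem ht, indicator_of_mem ht, Real.norm_of_nonneg (Real.exp_pos _).le]
      simpa [hσ] using IsC0Semigroup.norm_cexp_smul_orbit_le hM (σ : ℂ) x (le_of_lt ht)
    · rw [hf, indicator_of_notMem ht, norm_zero]; positivity
  have hfp : MemLp f p volume := hgp.of_le_mul hfI.1 (Eventually.of_forall hfg)
  have hfn : eLpNorm f p volume ≤ ENNReal.ofReal (M * ‖x‖) * eLpNorm g p volume :=
    eLpNorm_le_mul_eLpNorm_of_ae_le_mul (Eventually.of_forall hfg) p
  have hFf : ∀ s, 𝓕 f s = resolvent (generator T)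
      ((σ : ℂ) + ((2 * Real.pi * s : ℝ) : ℂ) * Complex.I) x := by
    intro s
    set z : ℂ := (σ : ℂ) + ((2 * Real.pi * s : ℝ) : ℂ) * Complex.I with hz
    have hzr : z.re = σ := by simp [hz]
    rw [Real.fourier_real_eq_integral_exp_smul, ← hT.integral_laplace hM (z := z) (by linarith)
      (hA z (by linarith)).1, ← integral_indicator measurableSet_Ioi]
    congr 1
    ext t
    by_cases ht : t ∈ Ioi (0 : ℝ)
    · rw [hf, indicator_of_mem ht, indicator_of_mem ht, smul_smul, ← Complex.exp_add, hz]
      congr 2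
      push_cast
      ring
    · rw [hf, indicator_of_notMem ht, indicator_of_notMem ht, smul_zero]
  -- Write `R(w)x = R(z)x + (z - w)R(w)R(z)x` with `z`, `w` at equal height, so that `z - w = σ + ε`
  -- does not depend on `s`.
  have hle : ∀ s : ℝ, ‖resolvent (generator T)
      (((-ε : ℝ) : ℂ) + ((2 * Real.pi * s : ℝ) : ℂ) * Complex.I) x‖ ≤
      (1 + (σ + ε) * K) * ‖𝓕 f s‖ := by
    intro s
    rw [hFf]
    set z : ℂ := (σ : ℂ) + ((2 * Real.pi * s : ℝ) : ℂ) * Complex.I with hz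
    set w : ℂ := ((-ε : ℝ) : ℂ) + ((2 * Real.pi * s : ℝ) : ℂ) * Complex.I with hw
    have hzr : z.re = σ := by simp [hz]
    have hwr : w.re = -ε := by simp [hw]
    have h1 := resolvent_apply_sub (hA w (by linarith)).1 (hA z (by linarith)).1 x
    have h2 : z - w = ((σ + ε : ℝ) : ℂ) := by rw [hz, hw]; push_cast; ring
    rw [h2, sub_eq_iff_eq_add] at h1
    rw [h1]
    refine (norm_add_le _ _).trans ?_
    rw [norm_smul, Complex.norm_real, Real.norm_of_nonneg (by linarith),
      show ∀ n : ℝ, (1 + (σ + ε) * K) * n = (σ + ε) * (K * n) + n by intro n; ring]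
    gcongr
    exact (resolvent (generator T) w).le_of_opNorm_le (hA w (by linarith)).2 _
  refine (eLpNorm_le_mul_eLpNorm_of_ae_le_mul (Eventually.of_forall hle) q).trans ?_
  rw [ENNReal.coe_mul, ENNReal.coe_mul, ENNReal.coe_mul, ENNReal.coe_toNNReal hgp.2.ne, mul_assoc]
  refine mul_le_mul' le_rfl ((hC f hfI hfp).trans ?_)
  rw [mul_assoc]
  refine mul_le_mul' le_rfl (hfn.trans_eq ?_)
  rw [ENNReal.ofReal_mul (by linarith), ofReal_norm, mul_assoc, mul_assoc, mul_comm ‖x‖ₑ]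
  rfl

include hC in
theorem eLpNorm_fourierInv_le {f : ℝ → X} (hf : Integrable f) (hfp : MemLp f p volume) :
    eLpNorm (𝓕⁻ f) q volume ≤ C * eLpNorm f p volume := by
  have hmp : MeasurePreserving (fun t : ℝ => -t) volume volume := Measure.measurePreserving_neg _
  rw [Real.fourierInv_eq_fourier_comp_neg, ← eLpNorm_comp_measurePreserving hfp.1 hmp]
  exact hC _ hf.comp_neg (hfp.comp_measurePreserving hmp)

omit [NormedSpace ℂ X] in
-- Some value is at most the mean, and on an interval of length 1 the mean is at most the `L^q`
-- norm.
theorem exists_mem_Ioc_enorm_le {v : ℝ → X} (hv : Continuous v) (hq : 1 ≤ q) (t : ℝ) :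
    ∃ r ∈ Ioc (t - 1) t, ‖v r‖ₑ ≤ eLpNorm v q volume := by
  have hvol : volume (Ioc (t - 1) t) = 1 := by simp
  have : IsProbabilityMeasure (volume.restrict (Ioc (t - 1) t)) := ⟨by simp⟩
  obtain ⟨r, hr, h⟩ := exists_le_setLAverage (μ := volume) (s := Ioc (t - 1) t)
    (f := fun r => ‖v r‖ₑ) (by simp) (by simp) hv.enorm.aemeasurable
  refine ⟨r, hr, h.trans ?_⟩
  rw [setLAverage_eq, hvol, div_one, ← eLpNorm_one_eq_lintegral_enorm]
  exact (eLpNorm_le_eLpNorm_of_exponent_le hq hv.aestronglyMeasurable).trans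
    (eLpNorm_mono_measure _ Measure.restrict_le_self)

include hA hC in
/-- Decay of differences of the convolutions `expConv T l x`, uniformly in `l` and `m`. -/
theorem exists_norm_expConv_sub_le [CompleteSpace X] (hp0 : p ≠ 0) (hp : p ≠ ∞) (hq : 1 ≤ q)
    {r : ℝ≥0∞} [hpqr : ENNReal.HolderTriple r q p] (hT : IsC0Semigroup T) {ε : ℝ} (hε0 : 0 ≤ ε)
    (hεa : ε < a) (hε : ε ≤ 1 / 2) :
    ∃ D : ℝ, 0 ≤ D ∧ ∀ l m N : ℝ, 1 ≤ l → 1 ≤ m → 0 ≤ N →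
      eLpNorm (fun s : ℝ => kernelDiff l m
        (((-ε : ℝ) : ℂ) + ((2 * Real.pi * s : ℝ) : ℂ) * Complex.I)) r volume ≤ ENNReal.ofReal N →
      ∀ (x : X) (t : ℝ), 1 ≤ t → ‖expConv T l x t - expConv T m x t‖ ≤
        D * (N + 1 / l + 1 / m) * Real.exp (-ε * t) * ‖x‖ := by
  obtain ⟨M, ω, hM1, hω1, hM⟩ := hT.exists_growth_bound
  obtain ⟨D, hD⟩ := exists_eLpNorm_resolvent_vertical_le hA hC hp0 hp hT hε0 hεa
  set M1 : ℝ := M * Real.exp ω with hM1def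
  have hM1pos : 0 < M1 := by positivity
  have hM1one : 1 ≤ M1 := by
    have := Real.one_le_exp (show 0 ≤ ω by linarith)
    nlinarith
  have hTs : ∀ s : ℝ, 0 ≤ s → s ≤ 1 → ‖T s‖ ≤ M1 := by
    intro s h0 h1
    refine (hM s h0).trans ?_
    rw [hM1def]
    gcongr
    nlinarith
  refine ⟨Real.exp 1 * M1 * (C * D + 1), by positivity, fun l m N hl hm hN hker x t ht => ?_⟩
  set f := expConvSymbol T ε l m x with hf
  set v : ℝ → X := 𝓕⁻ f with hv
  have hfI : Integrable f := integrable_expConvSymbol hA hεa hε hl hm x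
  have hfc : Continuous f := continuous_expConvSymbol hA hεa hε hl hm x
  have hRc : Continuous fun s : ℝ => resolvent (generator T)
      (((-ε : ℝ) : ℂ) + ((2 * Real.pi * s : ℝ) : ℂ) * Complex.I) x :=
    (continuous_resolvent_vertical hA (by linarith) _).clm_apply continuous_const
  have hkc : Continuous fun s : ℝ => kernelDiff l m
      (((-ε : ℝ) : ℂ) + ((2 * Real.pi * s : ℝ) : ℂ) * Complex.I) := by
    rw [continuous_iff_continuousAt]
    intro s
    exact ContinuousAt.comp (g := kernelDiff l m)
      (differentiableAt_kernelDiff hl hm (by simpa using hε)).continuousAt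
      (Continuous.continuousAt (by fun_prop))
  -- Hölder, with the kernel in `Lʳ` and the resolvent orbit in `L^q`.
  have hfn : eLpNorm f p volume ≤ ENNReal.ofReal N * (D * ‖x‖ₑ) :=
    (eLpNorm_smul_le_mul_eLpNorm hRc.aestronglyMeasurable hkc.aestronglyMeasurable).trans
      (mul_le_mul' hker (hD x))
  have hfp : MemLp f p volume := by
    refine ⟨hfc.aestronglyMeasurable, hfn.trans_lt ?_⟩
    exact ENNReal.mul_lt_top ENNReal.ofReal_lt_top (ENNReal.mul_lt_top ENNReal.coe_lt_top
      enorm_lt_top)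
  have hvn : eLpNorm v q volume ≤ ENNReal.ofReal (C * D * N * ‖x‖) := by
    refine ((eLpNorm_fourierInv_le hC hfI hfp).trans (mul_le_mul' le_rfl hfn)).trans_eq ?_
    rw [ENNReal.ofReal_mul (by positivity), ENNReal.ofReal_mul (by positivity),
      ENNReal.ofReal_mul (by positivity), ENNReal.ofReal_coe_nnreal, ENNReal.ofReal_coe_nnreal,
      ofReal_norm]
    ring
  have hvc : Continuous v := by
    rw [hv, Real.fourierInv_eq_fourier_comp_neg]
    exact VectorFourier.fourierIntegral_continuous Real.continuous_fourierChar
      (by exact continuous_inner) hfI.comp_neg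
  -- A good time `r'` exists in `(t - 1, t]`, nonnegative because `t ≥ 1`; `T (t - r')` then
  -- transports the bound to `t`.
  obtain ⟨r', ⟨hr1, hr2⟩, hr⟩ := exists_mem_Ioc_enorm_le hvc hq t
  have hvr : ‖v r'‖ ≤ C * D * N * ‖x‖ := by
    rw [← ofReal_norm] at hr
    exact (ENNReal.ofReal_le_ofReal_iff (by positivity)).1 (hr.trans hvn)
  have hr0 : 0 ≤ r' := by linarith
  set s := t - r' with hs
  have hs0 : 0 ≤ s := by linarith
  have hs1 : s ≤ 1 := by linarith
  have hts : t = r' + s := by rw [hs]; ring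
  have hd := expConv_sub_eq hA hT hε0 hεa hε hl hm x hr0
  have hexp : Real.exp (-ε * r') ≤ Real.exp 1 * Real.exp (-ε * t) := by
    rw [← Real.exp_add]
    apply Real.exp_le_exp.2
    nlinarith
  have hrem : ∀ b : ℝ, 1 ≤ b → ‖Complex.exp (-b * r') • expConv T b x s‖ ≤
      Real.exp 1 * Real.exp (-ε * t) * (M1 * ‖x‖ / b) := by
    intro b hb
    rw [norm_smul, Complex.norm_exp]
    have e : ((-b : ℂ) * r').re = -b * r' := by simp
    rw [e]
    have h1 : Real.exp (-b * r') ≤ Real.exp (-ε * r') := by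
      apply Real.exp_le_exp.2
      nlinarith
    have h2 := norm_expConv_le (by linarith) hM (by linarith : 0 < b) x hs0
    refine mul_le_mul (h1.trans hexp) (h2.trans ?_) (norm_nonneg _) (by positivity)
    rw [hM1def]
    gcongr
    nlinarith
  -- The two remainders from `expConv_add` account for the terms `1 / l` and `1 / m`.
  have hmain : expConv T l x t - expConv T m x t = T s (Real.exp (-ε * r') • v r') +
      (Complex.exp (-l * r') • expConv T l x s - Complex.exp (-m * r') • expConv T m x s) := by
    rw [hts, expConv_add hT l x hs0 hr0, expConv_add hT m x hs0 hr0, hv, ← hd, map_sub]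
    abel
  rw [hmain]
  calc _ ≤ ‖T s (Real.exp (-ε * r') • v r')‖ + (‖Complex.exp (-l * r') • expConv T l x s‖ +
        ‖Complex.exp (-m * r') • expConv T m x s‖) :=
        (norm_add_le _ _).trans (by gcongr; exact norm_sub_le _ _)
    _ ≤ M1 * (Real.exp 1 * Real.exp (-ε * t) * (C * D * N * ‖x‖)) +
        (Real.exp 1 * Real.exp (-ε * t) * (M1 * ‖x‖ / l) +
        Real.exp 1 * Real.exp (-ε * t) * (M1 * ‖x‖ / m)) := by
        gcongr
        · refine ((T s).le_of_opNorm_le (hTs s hs0 hs1) _).trans ?_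
          rw [norm_smul, Real.norm_of_nonneg (Real.exp_pos _).le]
          gcongr
        · exact hrem l hl
        · exact hrem m hm
    _ = Real.exp 1 * M1 * (C * D * N + 1 / l + 1 / m) * Real.exp (-ε * t) * ‖x‖ := by ring
    _ ≤ Real.exp 1 * M1 * ((C * D + 1) * (N + 1 / l + 1 / m)) * Real.exp (-ε * t) * ‖x‖ := by
        have h1 : 0 ≤ 1 / l := by positivity
        have h2 : 0 ≤ 1 / m := by positivity
        have h3 : (0 : ℝ) ≤ C * D := by positivity
        gcongr
        nlinarith [mul_nonneg h3 h1, mul_nonneg h3 h2]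
    _ = _ := by ring

end MainEstimate

/-! ### Norms of the scalar kernels. -/

section Kernel

/-- A weighted geometric mean of the lower bounds `l / 4` and `(1 + |s|) / 4` for `‖z + l‖`: decay
in `l` is traded for decay in `s`. -/
theorem norm_inv_add_ofReal_le {ε l β : ℝ} (hε : ε ≤ 1 / 2) (hl : 1 ≤ l) (hβ0 : 0 ≤ β) (hβ1 : β ≤ 1)
    (s : ℝ) : ‖((((-ε : ℝ) : ℂ) + ((2 * Real.pi * s : ℝ) : ℂ) * Complex.I) + l)⁻¹‖ ≤
      4 * l ^ (β - 1) * (1 + |s|) ^ (-β) := by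
  set z : ℂ := ((-ε : ℝ) : ℂ) + ((2 * Real.pi * s : ℝ) : ℂ) * Complex.I with hz
  have hre : z.re = -ε := by simp [hz]
  have him : z.im = 2 * Real.pi * s := by simp [hz]
  obtain ⟨h1, h2⟩ := norm_add_ofReal_ge (z := z) hl (by linarith)
  have h3 : (1 + |s|) / 4 ≤ ‖z + l‖ := by
    refine abs_le_of_sq_le_sq' (le_trans ?_ h2) (norm_nonneg _) |>.2
    have h4 : s ^ 2 ≤ z.im ^ 2 := by
      rw [him]
      have : 1 ≤ (2 * Real.pi) ^ 2 := by nlinarith [Real.pi_gt_three]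
      nlinarith [sq_nonneg s]
    nlinarith [sq_abs s, sq_nonneg (|s| - 1)]
  have hs : 0 < 1 + |s| := by positivity
  have hpos : 0 < ‖z + l‖ := by linarith
  have h4 : (l / 4) ^ (1 - β) * ((1 + |s|) / 4) ^ β ≤ ‖z + l‖ := by
    calc (l / 4) ^ (1 - β) * ((1 + |s|) / 4) ^ β ≤ ‖z + l‖ ^ (1 - β) * ‖z + l‖ ^ β := by
          gcongr
          linarith
      _ = ‖z + l‖ := by rw [← Real.rpow_add hpos]; simp
  have h5 : (l / 4) ^ (1 - β) * ((1 + |s|) / 4) ^ β =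
      (4 * l ^ (β - 1) * (1 + |s|) ^ (-β))⁻¹ := by
    rw [Real.div_rpow (by linarith) (by norm_num), Real.div_rpow hs.le (by norm_num),
      div_mul_div_comm, ← Real.rpow_add (by norm_num : (0 : ℝ) < 4), sub_add_cancel,
      Real.rpow_one, Real.rpow_neg hs.le, ← neg_sub 1 β, Real.rpow_neg (by linarith)]
    have : 0 < l ^ (1 - β) := Real.rpow_pos_of_pos (by linarith) _
    have : 0 < (1 + |s|) ^ β := Real.rpow_pos_of_pos hs _
    field_simp
  rw [norm_inv]
  rw [h5] at h4
  exact inv_le_of_inv_le₀ (by positivity) h4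

/-- The exponent is `1 / α`, so `β / α > 1` gives integrability; for `α = 0` it is `∞` and the
function is the constant 1. -/
theorem eLpNorm_bracket_lt_top {α β : ℝ} (h : 0 < α ∧ α < β ∨ α = 0 ∧ β = 0) :
    eLpNorm (fun s : ℝ => (1 + |s|) ^ (-β)) (ENNReal.ofReal α)⁻¹ volume < ∞ := by
  rcases h with ⟨hα, hαβ⟩ | ⟨rfl, rfl⟩
  · have h0 : ENNReal.ofReal α ≠ 0 := by simpa using hα
    have hc : Continuous fun s : ℝ => (1 + |s|) ^ (-β) :=
      Continuous.rpow_const (by fun_prop) fun s => Or.inl (by positivity)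
    have hi := integrable_one_add_norm (E := ℝ) (μ := volume) (r := β / α)
      (by rw [Module.finrank_self, Nat.cast_one, one_lt_div hα]; exact hαβ)
    have : MemLp (fun s : ℝ => (1 + |s|) ^ (-β)) (ENNReal.ofReal α)⁻¹ volume := by
      rw [← integrable_norm_rpow_iff hc.aestronglyMeasurable (by simp) (by simpa using h0)]
      refine hi.congr (Eventually.of_forall fun s => ?_)
      have hs : 0 < 1 + |s| := by positivity
      simp only
      rw [ENNReal.toReal_inv, ENNReal.toReal_ofReal hα.le,
        Real.norm_of_nonneg (Real.rpow_nonneg hs.le _), ← Real.rpow_mul hs.le, Real.norm_eq_abs]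
      congr 1
      rw [div_eq_mul_inv, neg_mul]
    exact this.2
  · simp only [neg_zero, Real.rpow_zero, ENNReal.ofReal_zero, ENNReal.inv_zero]
    exact (memLp_top_const (1 : ℝ)).2

theorem eLpNorm_le_of_norm_le_bracket {α β b : ℝ} (h : 0 < α ∧ α < β ∨ α = 0 ∧ β = 0)
    {f : ℝ → ℂ} (hf : ∀ s, ‖f s‖ ≤ b * (1 + |s|) ^ (-β)) (hb : 0 ≤ b) :
    eLpNorm f (ENNReal.ofReal α)⁻¹ volume ≤ ENNReal.ofReal (b *
      (eLpNorm (fun s : ℝ => (1 + |s|) ^ (-β)) (ENNReal.ofReal α)⁻¹ volume).toReal) := by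
  rw [ENNReal.ofReal_mul hb, ENNReal.ofReal_toReal (eLpNorm_bracket_lt_top h).ne]
  refine eLpNorm_le_mul_eLpNorm_of_ae_le_mul (Eventually.of_forall fun s => ?_) _
  rw [Real.norm_of_nonneg (Real.rpow_nonneg (by positivity) _)]
  exact hf s

end Kernel

/-! ### Decay of the convolutions and of `T(t)R(l)`. -/

section Decay

variable {X : Type*} [NormedAddCommGroup X] [NormedSpace ℂ X] [CompleteSpace X]
  {T : ℝ → X →L[ℂ] X}

/-- The estimate of `exists_norm_expConv_sub_le`, as a property of `T`, for exponents
`ε` (decay) and `1 / α` (integrability of the kernel). -/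
def ExpConvSubBound (T : ℝ → X →L[ℂ] X) (α ε D : ℝ) : Prop :=
  ∀ l m N : ℝ, 1 ≤ l → 1 ≤ m → 0 ≤ N →
    eLpNorm (fun s : ℝ => kernelDiff l m
      (((-ε : ℝ) : ℂ) + ((2 * Real.pi * s : ℝ) : ℂ) * Complex.I))
        (ENNReal.ofReal α)⁻¹ volume ≤ ENNReal.ofReal N →
    ∀ (x : X) (t : ℝ), 1 ≤ t → ‖expConv T l x t - expConv T m x t‖ ≤
      D * (N + 1 / l + 1 / m) * Real.exp (-ε * t) * ‖x‖

/-- Let `m → ∞` at fixed `t`: the crude bound sends `expConv T m x t` to 0, and `β < 1` makes the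
kernel norm `m^{β-1}` vanish. -/
theorem exists_norm_expConv_le (hT : IsC0Semigroup T) {α ε D : ℝ} (hε : ε ≤ 1 / 2) (hD0 : 0 ≤ D)
    (hD : ExpConvSubBound T α ε D) {β : ℝ} (hβ0 : 0 ≤ β) (hβ1 : β < 1)
    (hαβ : 0 < α ∧ α < β ∨ α = 0 ∧ β = 0) :
    ∃ D' : ℝ, 0 ≤ D' ∧ ∀ l : ℝ, 1 ≤ l → ∀ (x : X) (t : ℝ), 1 ≤ t →
      ‖expConv T l x t‖ ≤ D' * l ^ (β - 1) * Real.exp (-ε * t) * ‖x‖ := by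
  obtain ⟨M, ω, hM1, hω1, hM⟩ := hT.exists_growth_bound
  set G := (eLpNorm (fun s : ℝ => (1 + |s|) ^ (-β)) (ENNReal.ofReal α)⁻¹ volume).toReal with hG
  have hG0 : 0 ≤ G := ENNReal.toReal_nonneg
  refine ⟨D * (4 * G + 1), by positivity, fun l hl x t ht => ?_⟩
  have hbound : ∀ m : ℝ, 1 ≤ m → ‖expConv T l x t‖ ≤
      D * (4 * (l ^ (β - 1) + m ^ (β - 1)) * G + 1 / l + 1 / m) * Real.exp (-ε * t) * ‖x‖ +
        M * Real.exp (ω * t) * ‖x‖ / m := by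
    intro m hm
    have hl' : 0 ≤ l ^ (β - 1) := Real.rpow_nonneg (by linarith) _
    have hm' : 0 ≤ m ^ (β - 1) := Real.rpow_nonneg (by linarith) _
    have h1 := hD l m (4 * (l ^ (β - 1) + m ^ (β - 1)) * G) hl hm (by positivity)
      (eLpNorm_le_of_norm_le_bracket hαβ (fun s => by
        refine (norm_sub_le _ _).trans ((add_le_add (norm_inv_add_ofReal_le hε hl hβ0 hβ1.le s)
          (norm_inv_add_ofReal_le hε hm hβ0 hβ1.le s)).trans_eq ?_)
        ring) (by positivity)) x t ht
    have h2 := norm_expConv_le (by linarith) hM (by linarith : 0 < m) x (by linarith : 0 ≤ t)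
    calc ‖expConv T l x t‖ = ‖(expConv T l x t - expConv T m x t) + expConv T m x t‖ := by
          rw [sub_add_cancel]
      _ ≤ _ := (norm_add_le _ _).trans (add_le_add h1 h2)
  have hlim : Tendsto (fun m : ℝ => D * (4 * (l ^ (β - 1) + m ^ (β - 1)) * G + 1 / l + 1 / m) *
      Real.exp (-ε * t) * ‖x‖ + M * Real.exp (ω * t) * ‖x‖ / m) atTop
      (𝓝 (D * (4 * (l ^ (β - 1) + 0) * G + 1 / l + 0) * Real.exp (-ε * t) * ‖x‖ + 0)) := by
    have e1 : Tendsto (fun m : ℝ => m ^ (β - 1)) atTop (𝓝 0) := by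
      have := tendsto_rpow_neg_atTop (y := 1 - β) (by linarith)
      simpa using this
    have e2 : ∀ c : ℝ, Tendsto (fun m : ℝ => c / m) atTop (𝓝 0) := fun c =>
      tendsto_const_nhds.div_atTop tendsto_id
    exact ((((((e1.const_add _).const_mul 4).mul_const G).add_const _).add (e2 1)).const_mul D
      |>.mul_const _ |>.mul_const _).add (e2 _)
  refine (ge_of_tendsto hlim ((eventually_ge_atTop 1).mono hbound)).trans ?_
  rw [add_zero, add_zero, add_zero, show D * (4 * G + 1) * l ^ (β - 1) =
    D * (4 * l ^ (β - 1) * G + l ^ (β - 1)) by ring]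
  gcongr
  rw [one_div, ← Real.rpow_neg_one]
  exact Real.rpow_le_rpow_of_exponent_le hl (by linarith)

/-- In `orbit_resolvent_eq` the vectors `2lR(l)x - x` are bounded uniformly in `l`. The hypothesis
is imposed at a single pair `l`, `t` because for `α = 1` only `l = 1` is used. -/
theorem exists_norm_orbit_resolvent_le (hT : IsC0Semigroup T) {a K : ℝ} (ha : 0 < a)
    (hA : ∀ z : ℂ, -a < z.re → z ∈ resolventSet (generator T) ∧ ‖resolvent (generator T) z‖ ≤ K)
    {ε : ℝ} (hε : ε ≤ 1 / 2) {β : ℝ} (hβ0 : 0 ≤ β) {E : ℝ} (hE : 0 ≤ E) :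
    ∃ D' : ℝ, 0 ≤ D' ∧ ∀ l : ℝ, 1 ≤ l → ∀ t : ℝ, 1 ≤ t →
      (∀ x : X, ‖expConv T l x t‖ ≤ E * l ^ (β - 1) * Real.exp (-ε * t) * ‖x‖) → ∀ x : X,
      ‖T t (resolvent (generator T) l x)‖ ≤ D' * l ^ (β - 1) * Real.exp (-ε * t) * ‖x‖ := by
  obtain ⟨C, hC0, hC⟩ := exists_resolvent_real_decay hT ha hA
  refine ⟨E * (2 * C + 1) + C, by positivity, fun l hl t ht hw x => ?_⟩
  have hl0 : 0 < l := by linarith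
  have hR : ‖resolvent (generator T) (l : ℂ) x‖ ≤ C * l ^ (-1 : ℝ) * ‖x‖ := by
    refine (ContinuousLinearMap.le_of_opNorm_le _ (hC l hl0.le) x).trans ?_
    rw [Real.rpow_neg_one, ← div_eq_mul_inv]
    gcongr
    linarith
  have hx : ‖(2 * l : ℂ) • resolvent (generator T) l x - x‖ ≤ (2 * C + 1) * ‖x‖ := by
    refine (norm_sub_le _ _).trans ?_
    have e : ‖(2 * l : ℂ)‖ = 2 * l := by simp [abs_of_pos hl0]
    rw [norm_smul, e]
    have : 2 * l * ‖resolvent (generator T) (l : ℂ) x‖ ≤ 2 * l * (C * l ^ (-1 : ℝ) * ‖x‖) := by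
      gcongr
    rw [Real.rpow_neg_one] at this
    field_simp at this
    nlinarith
  have hlβ : l ^ (-1 : ℝ) ≤ l ^ (β - 1) := Real.rpow_le_rpow_of_exponent_le hl (by linarith)
  rw [orbit_resolvent_eq hT (hA _ (by simp; linarith)).1 x (by linarith)]
  have hexp : ‖Complex.exp (-l * t)‖ ≤ Real.exp (-ε * t) := by
    rw [Complex.norm_exp]
    apply Real.exp_le_exp.2
    simp
    nlinarith
  calc _ ≤ E * l ^ (β - 1) * Real.exp (-ε * t) * ((2 * C + 1) * ‖x‖) +
        Real.exp (-ε * t) * (C * l ^ (β - 1) * ‖x‖) := by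
        refine (norm_add_le _ _).trans (add_le_add ((hw _).trans ?_) ?_)
        · gcongr
        · rw [norm_smul]
          refine mul_le_mul hexp (hR.trans ?_) (norm_nonneg _) (by positivity)
          gcongr
    _ = _ := by ring

/-- Exponential stability when the kernel only needs to be bounded. -/
theorem exists_decay_zero (hT : IsC0Semigroup T) {ε D : ℝ} (hε : ε ≤ 1 / 2) (hD0 : 0 ≤ D)
    (hD : ExpConvSubBound T 0 ε D) :
    ∃ D' : ℝ, 0 ≤ D' ∧ ∀ (x : X) (t : ℝ), 1 ≤ t → ‖T t x‖ ≤ D' * Real.exp (-ε * t) * ‖x‖ := by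
  obtain ⟨D', hD'0, hD'⟩ := exists_norm_expConv_le hT hε hD0 hD le_rfl zero_lt_one
    (Or.inr ⟨rfl, rfl⟩)
  refine ⟨D', hD'0, fun x t ht => ?_⟩
  -- With `β = 0` the bound is of order `l⁻¹`, which the factor `l` cancels.
  refine le_of_tendsto (tendsto_smul_expConv hT x (by linarith : 0 < t)).norm ?_
  filter_upwards [eventually_ge_atTop 1] with l hl
  have hl0 : 0 < l := by linarith
  rw [norm_smul, Real.norm_of_nonneg hl0.le]
  calc l * ‖expConv T l x t‖ ≤ l * (D' * l ^ ((0 : ℝ) - 1) * Real.exp (-ε * t) * ‖x‖) := by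
        gcongr
        exact hD' l hl x t ht
    _ = D' * Real.exp (-ε * t) * ‖x‖ := by
        rw [zero_sub, Real.rpow_neg_one]; field_simp

/-- The kernel must lie in `L¹`, which `(z + 1)⁻¹` alone misses logarithmically. So `m` stays finite
and grows with `t`, at the cost of half the decay rate. -/
theorem exists_decay_one (hT : IsC0Semigroup T) {a K : ℝ} (ha : 0 < a)
    (hA : ∀ z : ℂ, -a < z.re → z ∈ resolventSet (generator T) ∧ ‖resolvent (generator T) z‖ ≤ K)
    {ε D : ℝ} (hε0 : 0 < ε) (hε : ε ≤ 1 / 2) (hD0 : 0 ≤ D) (hD : ExpConvSubBound T 1 ε D) :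
    ∃ D' : ℝ, 0 ≤ D' ∧ ∀ (x : X) (t : ℝ), 1 ≤ t →
      ‖T t (resolvent (generator T) (1 : ℝ) x)‖ ≤ D' * Real.exp (-(ε / 2) * t) * ‖x‖ := by
  obtain ⟨M, ω, hM1, hω1, hM⟩ := hT.exists_growth_bound
  set κ := ω + ε with hκ
  have hκ0 : 0 < κ := by linarith
  -- For `m = e^{κt}` this makes the loss `m^δ` equal to `e^{εt/2}`, while `κ = ω + ε` makes `e^{ωt}
  -- / m` equal to `e^{-εt}`.
  set δ := ε / (2 * κ) with hδ
  have hδ0 : 0 < δ := by positivity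
  have hδ1 : δ ≤ 1 := by rw [hδ, div_le_one (by positivity)]; linarith
  set G := (eLpNorm (fun s : ℝ => (1 + |s|) ^ (-(1 + δ)))
    (ENNReal.ofReal 1)⁻¹ volume).toReal with hG
  have hG0 : 0 ≤ G := ENNReal.toReal_nonneg
  obtain ⟨D', hD'0, hD'⟩ := exists_norm_orbit_resolvent_le hT ha hA (ε := ε / 2) (by linarith)
    (β := 0) le_rfl (E := D * (16 * G + 2) + M) (by positivity)
  refine ⟨D', hD'0, fun x t ht => ?_⟩
  have h := hD' 1 le_rfl t ht (fun x => ?_) x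
  · simpa using h
  set m := Real.exp (κ * t) with hm
  have hm1 : 1 ≤ m := Real.one_le_exp (by positivity)
  have hm0 : 0 < m := by linarith
  have hmδ : m ^ δ = Real.exp (ε / 2 * t) := by
    rw [hm, ← Real.exp_mul, hδ]
    congr 1
    field_simp
  have hker : ∀ s : ℝ, ‖kernelDiff 1 m (((-ε : ℝ) : ℂ) +
      ((2 * Real.pi * s : ℝ) : ℂ) * Complex.I)‖ ≤ 16 * m ^ δ * (1 + |s|) ^ (-(1 + δ)) := by
    intro s
    have h1 := norm_inv_add_ofReal_le hε le_rfl zero_le_one le_rfl s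
    have h2 := norm_inv_add_ofReal_le hε hm1 hδ0.le hδ1 s
    set z : ℂ := ((-ε : ℝ) : ℂ) + ((2 * Real.pi * s : ℝ) : ℂ) * Complex.I with hz
    have hre : z.re = -ε := by simp [hz]
    have e : kernelDiff 1 m z = ((m - 1 : ℝ) : ℂ) * ((z + (1 : ℝ))⁻¹ * (z + m)⁻¹) := by
      rw [kernelDiff, inv_sub_inv (add_ofReal_ne_zero le_rfl (by linarith))
        (add_ofReal_ne_zero hm1 (by linarith)), div_eq_mul_inv, mul_inv]
      push_cast
      ring
    rw [e, norm_mul, norm_mul, Complex.norm_real, Real.norm_of_nonneg (by linarith)]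
    calc (m - 1) * (‖(z + (1 : ℝ))⁻¹‖ * ‖(z + m)⁻¹‖)
        ≤ m * ((4 * 1 ^ ((1 : ℝ) - 1) * (1 + |s|) ^ (-(1 : ℝ))) *
          (4 * m ^ (δ - 1) * (1 + |s|) ^ (-δ))) := by
          gcongr
          linarith
      _ = 16 * (m * m ^ (δ - 1)) * ((1 + |s|) ^ (-(1 : ℝ)) * (1 + |s|) ^ (-δ)) := by
          rw [Real.one_rpow]; ring
      _ = _ := by
          rw [← Real.rpow_add (by positivity), ← Real.rpow_one_add' hm0.le (by linarith)]
          congr 2 <;> ring_nf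
  have h1 := hD 1 m (16 * m ^ δ * G) le_rfl hm1 (by positivity)
    (eLpNorm_le_of_norm_le_bracket (Or.inl ⟨zero_lt_one, by linarith⟩) hker (by positivity)) x t ht
  have h2 := norm_expConv_le (by linarith) hM hm0 x (by linarith : 0 ≤ t)
  have hmexp : Real.exp (ω * t) / m ≤ Real.exp (-(ε / 2) * t) := by
    rw [hm, ← Real.exp_sub]
    apply Real.exp_le_exp.2
    rw [hκ]
    nlinarith
  have hbig : 1 ≤ m ^ δ := Real.one_le_rpow hm1 hδ0.le
  have hfac : 16 * m ^ δ * G + 1 / 1 + 1 / m ≤ (16 * G + 2) * m ^ δ := by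
    have : 1 / m ≤ 1 := by rw [div_le_one hm0]; exact hm1
    linarith
  have hmul : m ^ δ * Real.exp (-ε * t) = Real.exp (-(ε / 2) * t) := by
    rw [hmδ, ← Real.exp_add]; ring_nf
  calc ‖expConv T 1 x t‖ = ‖(expConv T 1 x t - expConv T m x t) + expConv T m x t‖ := by
        rw [sub_add_cancel]
    _ ≤ D * (16 * m ^ δ * G + 1 / 1 + 1 / m) * Real.exp (-ε * t) * ‖x‖ +
        M * Real.exp (ω * t) * ‖x‖ / m := (norm_add_le _ _).trans (add_le_add h1 h2)
    _ ≤ D * ((16 * G + 2) * m ^ δ) * Real.exp (-ε * t) * ‖x‖ +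
        M * ‖x‖ * (Real.exp (ω * t) / m) := by
        refine add_le_add ?_ (le_of_eq (by ring))
        gcongr
    _ ≤ D * (16 * G + 2) * (m ^ δ * Real.exp (-ε * t)) * ‖x‖ +
        M * ‖x‖ * Real.exp (-(ε / 2) * t) := by
        refine add_le_add (le_of_eq (by ring)) ?_
        gcongr
    _ = _ := by rw [hmul, Real.one_rpow]; ring

end Decay

/-! ### Integrable power weights on the half-line. -/

section PowerWeight

/-- The function equal to `t^{-κ}` on `(0, 1]` and to `t^{-1-γ}` on `(1, ∞)`. -/
noncomputable def powerWeight (κ γ t : ℝ) : ℝ := if t ≤ 1 then t ^ (-κ) else t ^ (-1 - γ)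

theorem integrableOn_powerWeight {κ γ : ℝ} (hκ : κ < 1) (hγ : 0 < γ) :
    IntegrableOn (powerWeight κ γ) (Ioi 0) := by
  rw [← Ioc_union_Ioi_eq_Ioi zero_le_one]
  refine IntegrableOn.union ?_ ?_
  · have h : IntervalIntegrable (fun t : ℝ => t ^ (-κ)) volume 0 1 :=
      intervalIntegral.intervalIntegrable_rpow' (by linarith)
    refine ((intervalIntegrable_iff_integrableOn_Ioc_of_le zero_le_one).1 h).congr_fun
      (fun t ht => ?_) measurableSet_Ioc
    simp [powerWeight, ht.2]
  · refine (integrableOn_Ioi_rpow_of_lt (a := -1 - γ) (by linarith) zero_lt_one).congr_fun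
      (fun t ht => ?_) measurableSet_Ioi
    have ht : 1 < t := ht
    simp [powerWeight, not_le.2 ht]

theorem powerWeight_nonneg {κ γ t : ℝ} (ht : 0 ≤ t) : 0 ≤ powerWeight κ γ t := by
  unfold powerWeight
  split_ifs <;> exact Real.rpow_nonneg ht _

theorem rpow_neg_div_one_add_le {κ t : ℝ} (ht : 0 < t) :
    t ^ (-κ) / (1 + t) ≤ powerWeight κ κ t := by
  have h0 : 0 ≤ t ^ (-κ) := Real.rpow_nonneg ht.le _
  unfold powerWeight
  split_ifs with h
  · exact div_le_self h0 (by linarith)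
  · rw [show -1 - κ = -κ - 1 by ring, Real.rpow_sub_one ht.ne']
    gcongr
    linarith

theorem inv_one_add_le_rpow_neg {κ x : ℝ} (hx : 0 < x) (hκ0 : 0 ≤ κ) (hκ1 : κ ≤ 1) :
    (1 + x)⁻¹ ≤ x ^ (-κ) := by
  rw [Real.rpow_neg hx.le]
  have hp : 0 < x ^ κ := Real.rpow_pos_of_pos hx _
  gcongr
  rcases le_total x 1 with h | h
  · linarith [Real.rpow_le_one hx.le h hκ0]
  · have := Real.rpow_le_rpow_of_exponent_le h hκ1
    rw [Real.rpow_one] at this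
    linarith

theorem le_rpow_mul_rpow_of_le {x y c r θ : ℝ} (hx : 0 < x) (hy : 0 < y) (hc : 0 ≤ c)
    (hθ0 : 0 ≤ θ) (hθ1 : θ ≤ 1) (hrx : r ≤ c * x) (hry : r ≤ c * y) :
    r ≤ c * (x ^ θ * y ^ (1 - θ)) := by
  have e : ∀ {w : ℝ}, 0 < w → w ^ θ * w ^ (1 - θ) = w := fun hw => by
    rw [← Real.rpow_add hw]; simp
  rcases le_total x y with h | h
  · refine hrx.trans ?_
    gcongr
    nth_rewrite 1 [← e hx]
    gcongr
  · refine hry.trans ?_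
    gcongr
    nth_rewrite 1 [← e hy]
    gcongr

end PowerWeight

/-! ### Balakrishnan's integral and a Frullani integral for the resolvent. -/

section FracPow

variable {X : Type*} [NormedAddCommGroup X] [NormedSpace ℂ X]
  {T : ℝ → X →L[ℂ] X} {A : X →ₗ.[ℂ] X} {a K C : ℝ}

section

variable (ha : 0 < a)
  (hA : ∀ z : ℂ, -a < z.re → z ∈ resolventSet A ∧ ‖resolvent A z‖ ≤ K)
  (hC0 : 0 ≤ C) (hC : ∀ t : ℝ, 0 ≤ t → ‖resolvent A (t : ℂ)‖ ≤ C / (1 + t))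
include ha hA hC0 hC

theorem integrableOn_rpow_smul_resolvent {α : ℝ} (hα0 : 0 < α) (hα1 : α < 1) :
    IntegrableOn (fun t : ℝ => ((t ^ (-α) : ℝ) : ℂ) • resolvent A (t : ℂ)) (Ioi 0) := by
  refine Integrable.mono' ((integrableOn_powerWeight hα1 hα0).const_mul C)
    (ContinuousOn.aestronglyMeasurable ?_ measurableSet_Ioi) ?_
  · refine ContinuousOn.smul (f := fun t : ℝ => ((t ^ (-α) : ℝ) : ℂ)) ?_
      ((continuousOn_resolvent_real hA).mono fun t ht => ?_)
    · exact Complex.continuous_ofReal.comp_continuousOn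
        (continuousOn_id.rpow_const fun t ht => Or.inl (ne_of_gt ht))
    · have : 0 < t := ht
      exact (show -a < t by linarith)
  · filter_upwards [self_mem_ae_restrict measurableSet_Ioi] with t ht
    have ht : 0 < t := ht
    have hp : 0 ≤ t ^ (-α) := Real.rpow_nonneg ht.le _
    rw [norm_smul, Complex.norm_real, Real.norm_of_nonneg hp]
    calc t ^ (-α) * ‖resolvent A (t : ℂ)‖ ≤ t ^ (-α) * (C / (1 + t)) := by
          gcongr
          exact hC t ht.le
      _ = C * (t ^ (-α) / (1 + t)) := by ring
      _ ≤ C * powerWeight α α t := by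
          gcongr
          exact rpow_neg_div_one_add_le ht

theorem negFracPow_apply [CompleteSpace X] {α : ℝ} (hα0 : 0 < α) (hα1 : α < 1) (y : X) :
    negFracPow A α y = ((Real.sin (Real.pi * α) / Real.pi : ℝ) : ℂ) •
      ∫ t : ℝ in Ioi 0, ((t ^ (-α) : ℝ) : ℂ) • resolvent A (t : ℂ) y := by
  rw [negFracPow, _root_.smul_apply, ContinuousLinearMap.integral_apply
    (integrableOn_rpow_smul_resolvent ha hA hC0 hC hα0 hα1)]
  rfl

theorem integrableOn_rpow_smul_resolvent_apply {α : ℝ} (hα0 : 0 < α) (hα1 : α < 1) (y : X) :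
    IntegrableOn (fun t : ℝ => ((t ^ (-α) : ℝ) : ℂ) • resolvent A (t : ℂ) y) (Ioi 0) :=
  (integrableOn_rpow_smul_resolvent ha hA hC0 hC hα0 hα1).apply_continuousLinearMap y

omit ha hA in
-- The free `κ` sets the power of `v`; different values serve near `v = 0` and near `v = ∞`.
theorem norm_resolvent_mul_resolvent_le {s v κ : ℝ} (hs : 0 < s) (hv : 0 < v) (hκ0 : 0 ≤ κ)
    (hκ1 : κ ≤ 1) (y : X) :
    ‖resolvent A (s : ℂ) (resolvent A ((s * v : ℝ) : ℂ) y)‖ ≤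
      C ^ 2 * ‖y‖ * (v ^ (-κ) * powerWeight κ κ s) := by
  have hsv : 0 < s * v := by positivity
  have h1 := (resolvent A (s : ℂ)).le_of_opNorm_le (hC s hs.le)
    (resolvent A ((s * v : ℝ) : ℂ) y)
  have h2 := (resolvent A ((s * v : ℝ) : ℂ)).le_of_opNorm_le (hC _ hsv.le) y
  calc _ ≤ C / (1 + s) * (C / (1 + s * v) * ‖y‖) := h1.trans (by gcongr)
    _ = C ^ 2 * ‖y‖ * ((1 + s * v)⁻¹ / (1 + s)) := by ring
    _ ≤ C ^ 2 * ‖y‖ * ((s * v) ^ (-κ) / (1 + s)) := by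
        gcongr
        exact inv_one_add_le_rpow_neg hsv hκ0 hκ1
    _ = C ^ 2 * ‖y‖ * (v ^ (-κ) * (s ^ (-κ) / (1 + s))) := by
        rw [Real.mul_rpow hs.le hv.le]; ring
    _ ≤ _ := by
        have : 0 ≤ v ^ (-κ) := Real.rpow_nonneg hv.le _
        gcongr
        exact rpow_neg_div_one_add_le hs

/-- A Frullani integral for the resolvent. -/
theorem integral_resolvent_mul_resolvent [CompleteSpace X] {v : ℝ} (hv : 0 < v) (hv1 : v ≠ 1)
    (y : X) :
    ∫ s in Ioi (0 : ℝ), resolvent A (s : ℂ) (resolvent A ((s * v : ℝ) : ℂ) y) =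
      (Real.log v / (v - 1)) • resolvent A 0 y := by
  have hK0 : 0 ≤ K := (norm_nonneg _).trans (hA 0 (by simpa using ha)).2
  have hρ : ∀ t : ℝ, 0 ≤ t → (t : ℂ) ∈ resolventSet A := fun t ht => (hA _ (by simp; linarith)).1
  have hRc : ContinuousOn (fun t : ℝ => resolvent A (t : ℂ) y) (Ioi (-a)) :=
    (continuousOn_resolvent_real hA).clm_apply continuousOn_const
  set F : ℝ → X := fun s => resolvent A (s : ℂ) (resolvent A ((s * v : ℝ) : ℂ) y) with hF
  have hFI : IntegrableOn F (Ioi 0) := by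
    refine Integrable.mono' (((integrableOn_powerWeight (κ := 1 / 2) (by norm_num)
      (by norm_num : (0 : ℝ) < 1 / 2)).const_mul (v ^ (-(1 / 2 : ℝ)))).const_mul (C ^ 2 * ‖y‖))
      (ContinuousOn.aestronglyMeasurable ?_ measurableSet_Ioi) ?_
    · refine ((continuousOn_resolvent_real hA).mono fun t ht => ?_).clm_apply
        (hRc.comp (by fun_prop) fun t ht => ?_)
      · have : 0 < t := ht
        exact (show -a < t by linarith)
      · have : 0 < t * v := mul_pos ht hv
        exact (show -a < t * v by linarith)
    · filter_upwards [self_mem_ae_restrict measurableSet_Ioi] with s hs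
      exact norm_resolvent_mul_resolvent_le hC0 hC hs hv (by norm_num) (by norm_num) y
  set μ := min 1 v with hμ
  have hμ0 : 0 < μ := lt_min one_pos hv
  have hw0 : ∀ w ∈ uIcc 1 v, μ ≤ w := fun w hw => hw.1
  have hw0' : ∀ w ∈ uIoc 1 v, μ ≤ w := fun w hw => hw0 w (uIoc_subset_uIcc hw)
  -- For `s > 0` this is `∫ r in s..(s * v), r⁻¹ • R(r)y`, with derivative `-(v - 1) • F s` by the
  -- resolvent identity. The rescaled form also makes sense at `s = 0`, where it equals `log v •
  -- R(0)y`.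
  set H : ℝ → X := fun s => ∫ w in (1 : ℝ)..v, w⁻¹ • resolvent A ((s * w : ℝ) : ℂ) y with hH
  set φ : ℝ → X := fun r => r⁻¹ • resolvent A (r : ℂ) y with hφ
  have hφc : ContinuousOn φ (Ioi 0) := by
    refine ContinuousOn.smul (f := fun r : ℝ => r⁻¹) (continuousOn_inv₀.mono fun t ht => ne_of_gt ht) (hRc.mono ?_)
    exact Ioi_subset_Ioi (by linarith)
  have hφi : ∀ b c : ℝ, 0 < b → 0 < c → IntervalIntegrable φ volume b c := fun b c hb hc =>
    (hφc.mono fun t ht => (lt_min hb hc).trans_le ht.1).intervalIntegrable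
  have hHeq : ∀ s : ℝ, 0 < s → H s = (∫ r in (1 : ℝ)..(s * v), φ r) - ∫ r in (1 : ℝ)..s, φ r := by
    intro s hs
    rw [intervalIntegral.integral_interval_sub_left (hφi _ _ one_pos (by positivity))
      (hφi _ _ one_pos hs)]
    have h1 := intervalIntegral.smul_integral_comp_mul_left (a := 1) (b := v) φ s
    rw [mul_one] at h1
    rw [← h1, ← intervalIntegral.integral_smul]
    refine intervalIntegral.integral_congr fun w hw => ?_
    have hw' : 0 < w := hμ0.trans_le (hw0 w hw)
    simp only [hφ]
    rw [smul_smul]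
    congr 1
    field_simp
  have hφd : ∀ s : ℝ, 0 < s → HasDerivAt (fun u => ∫ r in (1 : ℝ)..u, φ r) (φ s) s := by
    intro s hs
    exact intervalIntegral.integral_hasDerivAt_right (hφi _ _ one_pos hs)
      (hφc.stronglyMeasurableAtFilter isOpen_Ioi s hs) (hφc.continuousAt (Ioi_mem_nhds hs))
  have hHd : ∀ s ∈ Ioi (0 : ℝ), HasDerivAt H (-((v - 1) • F s)) s := by
    intro s hs
    have hs : 0 < s := hs
    have hsv : 0 < s * v := by positivity
    have h1 : HasDerivAt (fun u : ℝ => u * v) v s := by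
      simpa using (hasDerivAt_id s).mul_const v
    have h2 := ((hφd (s * v) hsv).scomp s h1).sub (hφd s hs)
    refine (h2.congr_of_eventuallyEq ?_).congr_deriv ?_
    · filter_upwards [Ioi_mem_nhds hs] with u hu using hHeq u hu
    · have h3 := resolvent_apply_sub (hρ s hs.le) (hρ (s * v) hsv.le) y
      have h4 : ((s * v : ℝ) : ℂ) - (s : ℂ) = ((s * (v - 1) : ℝ) : ℂ) := by push_cast; ring
      rw [h4, Complex.coe_smul] at h3
      have h5 : (v - 1) • F s = s⁻¹ • (resolvent A (s : ℂ) y - resolvent A ((s * v : ℝ) : ℂ) y) := by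
        rw [h3, smul_smul, ← mul_assoc, inv_mul_cancel₀ hs.ne', one_mul]
      rw [h5, hφ, smul_smul, smul_sub, neg_sub]
      congr 2
      field_simp
  have hH0 : H 0 = Real.log v • resolvent A 0 y := by
    simp only [hH, zero_mul, Complex.ofReal_zero]
    rw [intervalIntegral.integral_smul_const, integral_inv (fun h => ?_), div_one]
    exact absurd (hw0 0 h) (not_le.2 hμ0)
  have hii : ∀ s : ℝ, 0 ≤ s → IntervalIntegrable
      (fun w : ℝ => w⁻¹ • resolvent A ((s * w : ℝ) : ℂ) y) volume 1 v := by
    intro s hs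
    refine ContinuousOn.intervalIntegrable (ContinuousOn.smul (f := fun r : ℝ => r⁻¹) (continuousOn_inv₀.mono fun t ht =>
      (hμ0.trans_le (hw0 t ht)).ne') (hRc.comp (by fun_prop) fun w hw => ?_))
    have : 0 ≤ s * w := mul_nonneg hs (hμ0.le.trans (hw0 w hw))
    exact (show -a < s * w by linarith)
  have hHcont : ContinuousWithinAt H (Ici 0) 0 := by
    rw [ContinuousWithinAt, tendsto_iff_norm_sub_tendsto_zero]
    have h1 : Tendsto (fun s : ℝ => K * K * ‖y‖ * s * |v - 1|) (𝓝[Ici 0] 0) (𝓝 0) := by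
      have : Continuous fun s : ℝ => K * K * ‖y‖ * s * |v - 1| := by fun_prop
      simpa using (this.tendsto 0).mono_left nhdsWithin_le_nhds
    refine squeeze_zero' (Eventually.of_forall fun _ => norm_nonneg _) ?_ h1
    filter_upwards [self_mem_nhdsWithin] with s hs
    have hs : 0 ≤ s := hs
    rw [hH]
    simp only
    rw [← intervalIntegral.integral_sub (hii s hs) (hii 0 le_rfl)]
    refine intervalIntegral.norm_integral_le_of_norm_le_const fun w hw => ?_
    have hw' : 0 < w := hμ0.trans_le (hw0' w hw)
    have hsw : 0 ≤ s * w := by positivity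
    have h2 := resolvent_apply_sub (hρ (s * w) hsw) (hρ (0 * w) (by simp)) y
    rw [← smul_sub, h2, norm_smul, norm_smul]
    have h3 : ‖((0 * w : ℝ) : ℂ) - ((s * w : ℝ) : ℂ)‖ = s * w := by
      rw [← Complex.ofReal_sub, Complex.norm_real, zero_mul, zero_sub, norm_neg,
        Real.norm_of_nonneg hsw]
    rw [h3, Real.norm_of_nonneg (by positivity)]
    have h4 := (resolvent A ((s * w : ℝ) : ℂ)).le_of_opNorm_le (hA _ (by simp; linarith)).2
      (resolvent A ((0 * w : ℝ) : ℂ) y)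
    have h5 := (resolvent A ((0 * w : ℝ) : ℂ)).le_of_opNorm_le (hA _ (by simpa using ha)).2 y
    calc _ ≤ w⁻¹ * (s * w * (K * (K * ‖y‖))) := by
          gcongr
          exact h4.trans (by gcongr)
      _ = K * K * ‖y‖ * s := by field_simp
  have hHtop : Tendsto H atTop (𝓝 0) := by
    have h1 : Tendsto (fun s : ℝ => C * ‖y‖ / (μ * μ) / s * |v - 1|) atTop (𝓝 0) := by
      simpa using (tendsto_const_nhds (x := C * ‖y‖ / (μ * μ)).div_atTop tendsto_id).mul_const
        |v - 1|
    refine squeeze_zero_norm' ?_ h1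
    filter_upwards [eventually_gt_atTop 0] with s hs
    refine intervalIntegral.norm_integral_le_of_norm_le_const fun w hw => ?_
    have hμw := hw0' w hw
    have hw' : 0 < w := hμ0.trans_le hμw
    rw [norm_smul, Real.norm_of_nonneg (by positivity)]
    have h2 := (resolvent A ((s * w : ℝ) : ℂ)).le_of_opNorm_le (hC (s * w) (by positivity)) y
    calc _ ≤ μ⁻¹ * (C / (s * μ) * ‖y‖) := by
          gcongr
          refine h2.trans ?_
          gcongr
          have : s * μ ≤ s * w := by gcongr
          linarith
      _ = C * ‖y‖ / (μ * μ) / s := by field_simp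
  have hfin := integral_Ioi_of_hasDerivAt_of_tendsto hHcont hHd
    (hFI.smul (v - 1)).neg hHtop
  rw [integral_neg, integral_smul, hH0, zero_sub, neg_inj] at hfin
  have hv1' : v - 1 ≠ 0 := sub_ne_zero.2 hv1
  rw [div_eq_inv_mul, ← smul_smul, ← hfin, smul_smul, inv_mul_cancel₀ hv1', one_smul]

end

end FracPow

/-! ### Injectivity of the negative fractional power. -/

section Injective

variable {X : Type*} [NormedAddCommGroup X] [NormedSpace ℂ X] [CompleteSpace X]
  {A : X →ₗ.[ℂ] X} {a K C : ℝ}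

/-- Rescale the vanishing integral by `t = sv`, apply `R(s)`, and integrate over `s`. After Fubini
the Frullani integral leaves `R(0)y` times `∫ v^{-α} log v / (v - 1) dv`, a positive number, and
`R(0)` is injective. -/
theorem eq_zero_of_negFracPow_apply_eq_zero (ha : 0 < a)
    (hA : ∀ z : ℂ, -a < z.re → z ∈ resolventSet A ∧ ‖resolvent A z‖ ≤ K)
    (hC0 : 0 ≤ C) (hC : ∀ t : ℝ, 0 ≤ t → ‖resolvent A (t : ℂ)‖ ≤ C / (1 + t))
    {α : ℝ} (hα0 : 0 < α) (hα1 : α < 1) {y : X} (hy : negFracPow A α y = 0) : y = 0 := by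
  set g : ℝ → X := fun t => ((t ^ (-α) : ℝ) : ℂ) • resolvent A (t : ℂ) y with hg
  have hgI : IntegrableOn g (Ioi 0) :=
    integrableOn_rpow_smul_resolvent_apply ha hA hC0 hC hα0 hα1 y
  have hg0 : ∫ t in Ioi (0 : ℝ), g t = 0 := by
    rw [negFracPow_apply ha hA hC0 hC hα0 hα1, smul_eq_zero] at hy
    refine hy.resolve_left ?_
    have : 0 < Real.sin (Real.pi * α) := Real.sin_pos_of_pos_of_lt_pi (by positivity)
      (by nlinarith [Real.pi_pos])
    exact_mod_cast (div_pos this Real.pi_pos).ne'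
  set G : ℝ → ℝ → X := fun s v =>
    (v ^ (-α)) • resolvent A (s : ℂ) (resolvent A ((s * v : ℝ) : ℂ) y) with hG
  have hinner : ∀ s : ℝ, 0 < s → ∫ v in Ioi (0 : ℝ), G s v = 0 := by
    intro s hs
    have h1 := integral_comp_mul_left_Ioi g 0 hs
    rw [mul_zero, hg0, smul_zero] at h1
    have h2 : ∀ v ∈ Ioi (0 : ℝ), G s v = s ^ α • resolvent A (s : ℂ) (g (s * v)) := by
      intro v hv
      have hv : 0 < v := hv
      simp only [hG, hg]
      rw [Complex.coe_smul, ContinuousLinearMap.map_smul_of_tower, smul_smul,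
        Real.mul_rpow hs.le hv.le, ← mul_assoc, ← Real.rpow_add hs]
      simp
    rw [setIntegral_congr_fun measurableSet_Ioi h2, integral_smul,
      ContinuousLinearMap.integral_comp_comm, h1, map_zero, smul_zero]
    exact (integrableOn_Ioi_comp_mul_left_iff g 0 hs).2 (by simpa using hgI)
  -- `κ₁` is used for `v ≤ 1` and `κ₂` for `v > 1`: the powers of `v` become `-(1 + α)/2 > -1` and
  -- `-1 - α/2 < -1`.
  set κ₁ := (1 - α) / 2 with hκ₁
  set κ₂ := 1 - α / 2 with hκ₂
  have hGI : Integrable (Function.uncurry G)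
      ((volume.restrict (Ioi (0 : ℝ))).prod (volume.restrict (Ioi (0 : ℝ)))) := by
    have hmaj := (((integrableOn_powerWeight (κ := κ₁) (γ := κ₁) (by linarith) (by linarith)).add
      (integrableOn_powerWeight (κ := κ₂) (γ := κ₂) (by linarith) (by linarith))).mul_prod
      (integrableOn_powerWeight (κ := (1 + α) / 2) (γ := α / 2) (by linarith)
        (by linarith))).const_mul (C ^ 2 * ‖y‖)
    refine hmaj.mono' ?_ ?_
    · rw [Measure.prod_restrict]
      refine ContinuousOn.aestronglyMeasurable ?_ (measurableSet_Ioi.prod measurableSet_Ioi)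
      have hR := continuousOn_resolvent_real hA
      refine ContinuousOn.smul (f := fun z : ℝ × ℝ => z.2 ^ (-α)) ?_
        ((hR.comp (g := fun t : ℝ => resolvent A (t : ℂ)) continuousOn_fst fun z hz => ?_).clm_apply
          ((hR.clm_apply continuousOn_const).comp (g := fun t : ℝ => resolvent A (t : ℂ) y)
            (f := fun z : ℝ × ℝ => z.1 * z.2) (by fun_prop) fun z hz => ?_))
      · exact continuousOn_snd.rpow_const fun z hz => Or.inl (ne_of_gt hz.2)
      · have : 0 < z.1 := hz.1
        exact (show -a < z.1 by linarith)
      · have : 0 < z.1 * z.2 := mul_pos hz.1 hz.2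
        exact (show -a < z.1 * z.2 by linarith)
    · rw [Measure.prod_restrict]
      filter_upwards [self_mem_ae_restrict (measurableSet_Ioi.prod measurableSet_Ioi)] with z hz
      obtain ⟨s, v⟩ := z
      have hs : 0 < s := hz.1
      have hv : 0 < v := hz.2
      have hvα : 0 ≤ v ^ (-α) := Real.rpow_nonneg hv.le _
      have hw₁ : 0 ≤ powerWeight κ₁ κ₁ s := powerWeight_nonneg hs.le
      have hw₂ : 0 ≤ powerWeight κ₂ κ₂ s := powerWeight_nonneg hs.le
      have hy0 := norm_nonneg y
      simp only [Function.uncurry, hG, Pi.add_apply]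
      rw [norm_smul, Real.norm_of_nonneg hvα]
      unfold powerWeight at *
      by_cases h : v ≤ 1
      · rw [if_pos h]
        have h1 := norm_resolvent_mul_resolvent_le hC0 hC hs hv (κ := κ₁) (by linarith)
          (by linarith) y
        have h2 : v ^ (-((1 + α) / 2)) = v ^ (-α) * v ^ (-κ₁) := by
          rw [← Real.rpow_add hv]; congr 1; rw [hκ₁]; ring
        have hvκ : 0 ≤ v ^ (-κ₁) := Real.rpow_nonneg hv.le _
        rw [h2]
        refine (mul_le_mul_of_nonneg_left h1 hvα).trans ?_
        rw [powerWeight]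
        have h3 : 0 ≤ C ^ 2 * ‖y‖ * (v ^ (-α) * v ^ (-κ₁)) := by positivity
        nlinarith [mul_nonneg h3 hw₂]
      · rw [if_neg h]
        have h1 := norm_resolvent_mul_resolvent_le hC0 hC hs hv (κ := κ₂) (by linarith)
          (by linarith) y
        have h2 : v ^ (-1 - α / 2) = v ^ (-α) * v ^ (-κ₂) := by
          rw [← Real.rpow_add hv]; congr 1; rw [hκ₂]; ring
        have hvκ : 0 ≤ v ^ (-κ₂) := Real.rpow_nonneg hv.le _
        rw [h2]
        refine (mul_le_mul_of_nonneg_left h1 hvα).trans ?_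
        rw [powerWeight]
        have h3 : 0 ≤ C ^ 2 * ‖y‖ * (v ^ (-α) * v ^ (-κ₂)) := by positivity
        nlinarith [mul_nonneg h3 hw₁]
  set ψ : ℝ → ℝ := fun v => v ^ (-α) * (Real.log v / (v - 1)) with hψ
  have hk : ∀ᵐ v ∂(volume.restrict (Ioi (0 : ℝ))),
      ∫ s in Ioi (0 : ℝ), G s v = ψ v • resolvent A 0 y := by
    have hne : ∀ᵐ v ∂(volume.restrict (Ioi (0 : ℝ))), v ≠ 1 :=
      ae_restrict_of_ae (by simp [ae_iff])
    filter_upwards [self_mem_ae_restrict measurableSet_Ioi, hne] with v hv hv1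
    simp only [hG]
    rw [integral_smul, integral_resolvent_mul_resolvent ha hA hC0 hC hv hv1, smul_smul]
  have hswap : ∫ v in Ioi (0 : ℝ), ψ v • resolvent A 0 y = 0 := by
    rw [← integral_congr_ae hk, ← integral_integral_swap hGI,
      setIntegral_congr_fun measurableSet_Ioi fun s hs => hinner s hs, integral_zero]
  have hψI : IntegrableOn (fun v => ψ v • resolvent A 0 y) (Ioi 0) :=
    (integrable_congr hk).1 hGI.integral_prod_right
  by_contra hy0
  have hR0 : resolvent A 0 y ≠ 0 := fun h => hy0
    (resolvent_injective (hA 0 (by simpa using ha)).1 (h.trans (map_zero _).symm))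
  have hψI' : IntegrableOn ψ (Ioi 0) := (integrable_smul_const hR0).1 hψI
  rw [integral_smul_const, smul_eq_zero] at hswap
  have hpos : ∀ v : ℝ, 0 < v → v ≠ 1 → 0 < ψ v := by
    intro v hv hv1
    refine mul_pos (Real.rpow_pos_of_pos hv _) ?_
    rcases lt_or_gt_of_ne hv1 with h | h
    · exact div_pos_of_neg_of_neg (Real.log_neg hv h) (by linarith)
    · exact div_pos (Real.log_pos h) (by linarith)
  have hint : 0 < ∫ v in Ioi (0 : ℝ), ψ v := by
    rw [setIntegral_pos_iff_support_of_nonneg_ae ?_ hψI']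
    · refine lt_of_lt_of_le ?_ (measure_mono (show Ioo (0 : ℝ) 1 ⊆ _ from fun v hv => ?_))
      · simp
      · exact ⟨(hpos v hv.1 hv.2.ne).ne', hv.1⟩
    · filter_upwards [self_mem_ae_restrict measurableSet_Ioi] with v hv
      by_cases h : v = 1
      · simp [hψ, h]
      · exact (hpos v hv h).le
  exact hint.ne' (hswap.resolve_right hR0)

end Injective

/-! ### Decay on the range of the negative fractional power. -/

section FracPowDecay

variable {X : Type*} [NormedAddCommGroup X] [NormedSpace ℂ X] [CompleteSpace X]
  {T : ℝ → X →L[ℂ] X}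

theorem exists_decay_negFracPow (hT : IsC0Semigroup T) {a K : ℝ} (ha : 0 < a)
    (hA : ∀ z : ℂ, -a < z.re → z ∈ resolventSet (generator T) ∧ ‖resolvent (generator T) z‖ ≤ K)
    {α ε D : ℝ} (hα0 : 0 < α) (hα1 : α < 1) (hε0 : 0 < ε) (hε : ε ≤ 1 / 2) (hD0 : 0 ≤ D)
    (hD : ExpConvSubBound T α ε D) :
    ∃ D' η : ℝ, 0 ≤ D' ∧ 0 < η ∧ ∀ (x : X) (t : ℝ), 1 ≤ t →
      ‖T t (negFracPow (generator T) α x)‖ ≤ D' * Real.exp (-η * t) * ‖x‖ := by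
  have hK0 : 0 ≤ K := (norm_nonneg _).trans (hA 0 (by simpa using ha)).2
  obtain ⟨M, ω, hM1, hω1, hM⟩ := hT.exists_growth_bound
  obtain ⟨C, hC0, hC⟩ := exists_resolvent_real_decay hT ha hA
  -- Interpolating with weight `θ` costs growth `ω(1 - θ) = εθ/2`, half of the decay `εθ`.
  set θ := ω / (ω + ε / 2) with hθ
  have hθ0 : 0 < θ := by positivity
  have hθ1 : θ < 1 := by rw [hθ, div_lt_one (by positivity)]; linarith
  have hθω : ω * (1 - θ) = ε / 2 * θ := by rw [hθ]; field_simp; ring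
  -- The kernel bound needs `α < β < 1`; integrability at infinity of `l^{-α + βθ - 1}` needs `βθ <
  -- α`. Both can hold because `θ < 1`.
  obtain ⟨β, hαβ, hβ⟩ := exists_between (lt_min hα1 ((lt_div_iff₀ hθ0).2
    (by nlinarith : α * θ < α)))
  have hβ1 : β < 1 := hβ.trans_le (min_le_left _ _)
  have hβθ : β * θ < α := (lt_div_iff₀ hθ0).1 (hβ.trans_le (min_le_right _ _))
  obtain ⟨E, hE0, hE⟩ := exists_norm_expConv_le hT hε hD0 hD (by linarith : 0 ≤ β) hβ1
    (Or.inl ⟨hα0, hαβ⟩)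
  obtain ⟨F, hF0, hF⟩ := exists_norm_orbit_resolvent_le hT ha hA hε (by linarith : 0 ≤ β) hE0
  have hTR : ∀ l : ℝ, 1 ≤ l → ∀ t : ℝ, 1 ≤ t → ∀ x : X,
      ‖T t (resolvent (generator T) l x)‖ ≤ F * l ^ (β - 1) * Real.exp (-ε * t) * ‖x‖ :=
    fun l hl t ht => hF l hl t ht fun x => hE l hl x t ht
  set η := ε / 2 * θ with hη
  have hη0 : 0 < η := by positivity
  have hηε : η ≤ ε := by rw [hη]; nlinarith
  set γ := α - β * θ with hγ
  set B := F * (1 + K) + M * C with hB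
  have hMC : 0 ≤ M * C := by positivity
  have hB0 : 0 ≤ B := by positivity
  have hFB : F ≤ B := by rw [hB]; nlinarith [mul_nonneg hF0 hK0]
  have hbound : ∀ (x : X) (t : ℝ), 1 ≤ t → ∀ l ∈ Ioi (0 : ℝ),
      ‖((l ^ (-α) : ℝ) : ℂ) • T t (resolvent (generator T) l x)‖ ≤
        B * Real.exp (-η * t) * ‖x‖ * powerWeight α γ l := by
    intro x t ht l hl
    have hl : 0 < l := hl
    have hlα : 0 < l ^ (-α) := Real.rpow_pos_of_pos hl _
    rw [norm_smul, Complex.norm_real, Real.norm_of_nonneg hlα.le]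
    -- The decay estimate requires `l ≥ 1`; smaller `l` are reduced to `l = 1` by `R(l) = R(1)(1 -
    -- (l - 1)R(l))`.
    by_cases hl1 : l ≤ 1
    · rw [powerWeight, if_pos hl1, mul_comm]
      gcongr
      have h1 := resolvent_apply_sub (hA ((1 : ℝ) : ℂ) (by simp; linarith)).1
        (hA (l : ℂ) (by simp; linarith)).1 x
      have h2 : resolvent (generator T) (l : ℂ) x = resolvent (generator T) ((1 : ℝ) : ℂ)
          (x - ((l - 1 : ℝ) : ℂ) • resolvent (generator T) (l : ℂ) x) := by
        rw [map_sub, map_smul, Complex.ofReal_sub, ← h1]; abel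
      have h3 : ‖x - ((l - 1 : ℝ) : ℂ) • resolvent (generator T) (l : ℂ) x‖ ≤ (1 + K) * ‖x‖ := by
        refine (norm_sub_le _ _).trans ?_
        rw [norm_smul, Complex.norm_real, Real.norm_eq_abs, add_mul, one_mul]
        refine add_le_add le_rfl ?_
        have h4 := (resolvent (generator T) (l : ℂ)).le_of_opNorm_le
          (hA (l : ℂ) (by simp; linarith)).2 x
        have h5 : |l - 1| ≤ 1 := abs_le.2 ⟨by linarith, by linarith⟩
        calc _ ≤ 1 * (K * ‖x‖) := by gcongr
          _ = _ := one_mul _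
      rw [h2]
      have h6 := hTR 1 le_rfl t ht (x - ((l - 1 : ℝ) : ℂ) • resolvent (generator T) (l : ℂ) x)
      rw [Real.one_rpow, mul_one] at h6
      calc _ ≤ F * Real.exp (-ε * t) * ((1 + K) * ‖x‖) := h6.trans (by gcongr)
        _ = F * (1 + K) * Real.exp (-ε * t) * ‖x‖ := by ring
        _ ≤ B * Real.exp (-η * t) * ‖x‖ := by
          gcongr
          rw [hB]
          linarith
    · rw [powerWeight, if_neg hl1]
      push Not at hl1
      have h1 : ‖T t (resolvent (generator T) l x)‖ ≤
          B * ‖x‖ * (l ^ (β - 1) * Real.exp (-ε * t)) := by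
        refine (hTR l hl1.le t ht x).trans ?_
        rw [show B * ‖x‖ * (l ^ (β - 1) * Real.exp (-ε * t)) =
          B * l ^ (β - 1) * Real.exp (-ε * t) * ‖x‖ by ring]
        gcongr
      have h2 : ‖T t (resolvent (generator T) l x)‖ ≤
          B * ‖x‖ * (l ^ (-1 : ℝ) * Real.exp (ω * t)) := by
        have h3 := (T t).le_of_opNorm_le (hM t (by linarith)) (resolvent (generator T) l x)
        have h4 := (resolvent (generator T) (l : ℂ)).le_of_opNorm_le (hC l hl.le) x
        calc _ ≤ M * Real.exp (ω * t) * (C / l * ‖x‖) := by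
              refine h3.trans ?_
              gcongr
              refine h4.trans ?_
              gcongr
              linarith
          _ = M * C * ‖x‖ * (l ^ (-1 : ℝ) * Real.exp (ω * t)) := by
              rw [Real.rpow_neg_one]; ring
          _ ≤ _ := by
              gcongr
              rw [hB]
              nlinarith [mul_nonneg hF0 hK0]
      have h5 := le_rpow_mul_rpow_of_le (by positivity) (by positivity) (by positivity) hθ0.le
        hθ1.le h1 h2
      have h6 : (l ^ (β - 1) * Real.exp (-ε * t)) ^ θ *
          (l ^ (-1 : ℝ) * Real.exp (ω * t)) ^ (1 - θ) =
          l ^ ((β - 1) * θ - (1 - θ)) * Real.exp (-η * t) := by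
        rw [Real.mul_rpow (by positivity) (by positivity),
          Real.mul_rpow (by positivity) (by positivity), ← Real.rpow_mul hl.le,
          ← Real.rpow_mul hl.le, ← Real.exp_mul, ← Real.exp_mul, mul_mul_mul_comm,
          ← Real.rpow_add hl, ← Real.exp_add]
        congr 2
        · ring
        · have : ω * t * (1 - θ) = η * t := by rw [← hθω]; ring
          rw [this, hη]; ring
      rw [h6] at h5
      calc _ ≤ l ^ (-α) * (B * ‖x‖ * (l ^ ((β - 1) * θ - (1 - θ)) * Real.exp (-η * t))) := by
            gcongr
        _ = B * Real.exp (-η * t) * ‖x‖ * (l ^ (-α) * l ^ ((β - 1) * θ - (1 - θ))) := by ring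
        _ = _ := by
            rw [← Real.rpow_add hl]
            congr 2
            rw [hγ]; ring
  have hwI := integrableOn_powerWeight (κ := α) (γ := γ) hα1 (by rw [hγ]; linarith)
  set I := ∫ l in Ioi (0 : ℝ), powerWeight α γ l with hI
  have hI0 : 0 ≤ I := setIntegral_nonneg measurableSet_Ioi fun l hl =>
    powerWeight_nonneg (le_of_lt hl)
  set c := ‖((Real.sin (Real.pi * α) / Real.pi : ℝ) : ℂ)‖ with hc
  refine ⟨c * (B * I), η, by positivity, hη0, fun x t ht => ?_⟩
  rw [negFracPow_apply ha hA hC0.le hC hα0 hα1, map_smul, norm_smul, ← hc,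
    ← ContinuousLinearMap.integral_comp_comm _
      (integrableOn_rpow_smul_resolvent_apply ha hA hC0.le hC hα0 hα1 x)]
  have h := norm_integral_le_of_norm_le (hwI.const_mul (B * Real.exp (-η * t) * ‖x‖))
    (f := fun l : ℝ => T t (((l ^ (-α) : ℝ) : ℂ) • resolvent (generator T) (l : ℂ) x)) (by
      filter_upwards [self_mem_ae_restrict measurableSet_Ioi] with l hl
      rw [map_smul]
      exact hbound x t ht l hl)
  rw [integral_const_mul, ← hI] at h
  calc _ ≤ c * (B * Real.exp (-η * t) * ‖x‖ * I) := by gcongr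
    _ = _ := by ring

/-- Exponential decay for `t ≥ 1` extends to `t ≥ 0`. -/
theorem exists_decay_of_one_le (hT : IsC0Semigroup T) (L : X →L[ℂ] X) {D η : ℝ} (hη : 0 ≤ η)
    (hD0 : 0 ≤ D) (hD : ∀ (x : X) (t : ℝ), 1 ≤ t → ‖T t (L x)‖ ≤ D * Real.exp (-η * t) * ‖x‖) :
    ∃ D' : ℝ, 0 ≤ D' ∧ ∀ (x : X) (t : ℝ), 0 ≤ t →
      ‖T t (L x)‖ ≤ D' * Real.exp (-η * t) * ‖x‖ := by
  obtain ⟨M, ω, hM1, hω1, hM⟩ := hT.exists_growth_bound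
  have hE : 0 ≤ M * Real.exp ω * ‖L‖ * Real.exp η := by positivity
  refine ⟨D + M * Real.exp ω * ‖L‖ * Real.exp η, by positivity, fun x t ht => ?_⟩
  rcases le_total 1 t with h | h
  · refine (hD x t h).trans ?_
    gcongr
    linarith
  · have h1 := (T t).le_of_opNorm_le (hM t ht) (L x)
    calc ‖T t (L x)‖ ≤ M * Real.exp ω * (‖L‖ * ‖x‖) * 1 := by
          rw [mul_one]
          refine h1.trans ?_
          gcongr
          · nlinarith
          · exact L.le_opNorm x
      _ ≤ M * Real.exp ω * (‖L‖ * ‖x‖) * (Real.exp η * Real.exp (-η * t)) := by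
          gcongr
          rw [← Real.exp_add]
          apply Real.one_le_exp
          nlinarith
      _ = M * Real.exp ω * ‖L‖ * Real.exp η * Real.exp (-η * t) * ‖x‖ := by ring
      _ ≤ _ := by
          gcongr
          linarith

end FracPowDecay

/-! ### Arithmetic of the exponents. -/

section Exponents

theorem inv_toReal_sub_inv_conjExponent_toReal {p : ℝ≥0∞} (hp1 : 1 ≤ p) (hp2 : p ≤ 2) {α : ℝ}
    (hα : α = (1 / p).toReal - (1 / ENNReal.conjExponent p).toReal) :
    0 ≤ α ∧ α ≤ 1 ∧
      ENNReal.HolderTriple (ENNReal.ofReal α)⁻¹ (ENNReal.conjExponent p) p := by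
  have hconj := ENNReal.HolderConjugate.conjExponent hp1
  set q := ENNReal.conjExponent p with hq
  have hsum : p⁻¹ + q⁻¹ = 1 := hconj.inv_add_inv_eq_one
  rw [one_div, one_div] at hα
  have hpt : p⁻¹ ≠ ∞ := fun h => by simp [h] at hsum
  have hqt : q⁻¹ ≠ ∞ := fun h => by simp [h] at hsum
  have hr : p⁻¹.toReal + q⁻¹.toReal = 1 := by
    rw [← ENNReal.toReal_add hpt hqt, hsum, ENNReal.toReal_one]
  have hp : (1 / 2 : ℝ) ≤ p⁻¹.toReal := by
    have := ENNReal.toReal_mono hpt (ENNReal.inv_le_inv.2 hp2)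
    simpa using this
  have hq0 : 0 ≤ q⁻¹.toReal := ENNReal.toReal_nonneg
  have hα0 : 0 ≤ α := by linarith
  refine ⟨hα0, by linarith, ⟨?_⟩⟩
  rw [inv_inv, ← ENNReal.ofReal_toReal hqt, ← ENNReal.ofReal_add hα0 hq0, hα, sub_add_cancel,
    ENNReal.ofReal_toReal hpt]

end Exponents

/-! ### Inverting the negative fractional power. -/

section FracPow

variable {X : Type*} [NormedAddCommGroup X] [NormedSpace ℂ X] {A : X →ₗ.[ℂ] X}

theorem fracPow_one : fracPow A 1 = -A := by
  simp [fracPow]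

/-- Injectivity enters because `LinearPMap.inverse` is a genuine inverse only when the kernel is
trivial. -/
theorem negFracPow_fracPow_apply {α : ℝ} (hα0 : 0 < α) (hα1 : α < 1)
    (hinj : ∀ y, negFracPow A α y = 0 → y = 0) (x : (fracPow A α).domain) :
    negFracPow A α (fracPow A α x) = x := by
  have e : fracPow A α = (((negFracPow A α : X →L[ℂ] X) : X →ₗ[ℂ] X).toPMap ⊤).inverse := by
    rw [fracPow, if_neg hα0.ne', if_neg hα1.ne]
  have hker : (((negFracPow A α : X →L[ℂ] X) : X →ₗ[ℂ] X).toPMap ⊤).toFun.ker = ⊥ := by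
    rw [LinearMap.ker_eq_bot']
    intro y hy
    exact Subtype.ext (hinj y hy)
  revert x
  rw [e]
  intro x
  obtain ⟨y, hy⟩ := LinearPMap.inverse_domain.le x.2
  rw [LinearPMap.inverse_apply_eq hker (x := y) hy]
  exact hy

end FracPow

end EvolutionEq

theorem theorem4p3 {X : Type*} [NormedAddCommGroup X] [NormedSpace ℂ X] [CompleteSpace X]
    (n : ℕ) (hn : 1 ≤ n) (p : ℝ≥0∞) (hp1 : 1 ≤ p) (hp2 : p ≤ 2)
    (hX : EvolutionEq.HasFourierType n X p)
    (T : ℝ → X →L[ℂ] X) (hT : EvolutionEq.IsC0Semigroup T)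
    (A : X →ₗ.[ℂ] X) (hA : A = EvolutionEq.generator T)
    (hρ : ∀ z : ℂ, 0 ≤ z.re → z ∈ EvolutionEq.resolventSet A)
    (hR : ∃ M : ℝ, ∀ z : ℂ, 0 ≤ z.re → ‖EvolutionEq.resolvent A z‖ ≤ M)
    (α : ℝ) (hα : α = (1 / p).toReal - (1 / ENNReal.conjExponent p).toReal) :
    ∃ C ω : ℝ, 0 ≤ C ∧ ω < 0 ∧
      ∀ (x : (EvolutionEq.fracPow A α).domain) (t : ℝ), 0 ≤ t →
        ‖T t (x : X)‖ ≤
          C * Real.exp (ω * t) * EvolutionEq.graphNorm (EvolutionEq.fracPow A α) x := by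
  subst hA
  obtain ⟨M, hM⟩ := hR
  obtain ⟨a, K, ha, ha1, -, hAK⟩ := EvolutionEq.exists_halfPlane_bound hρ hM
  obtain ⟨CF, hCF⟩ := hX.real hn hp1 hp2
  obtain ⟨hα0, hα1, hHolder⟩ :=
    EvolutionEq.inv_toReal_sub_inv_conjExponent_toReal hp1 hp2 hα
  have hp0 : p ≠ 0 := (zero_lt_one.trans_le hp1).ne'
  have hpt : p ≠ ∞ := (hp2.trans_lt (by simp)).ne
  have hq1 : 1 ≤ ENNReal.conjExponent p := by simp [ENNReal.conjExponent]
  obtain ⟨D, hD0, hD⟩ := EvolutionEq.exists_norm_expConv_sub_le hAK hCF hp0 hpt hq1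
    (r := (ENNReal.ofReal α)⁻¹) hT (ε := a / 2) (by linarith) (by linarith) (by linarith)
  have hD' : EvolutionEq.ExpConvSubBound T α (a / 2) D := hD
  have ha2 : a / 2 ≤ 1 / 2 := by linarith
  rcases hα0.eq_or_lt with rfl | hα0'
  · obtain ⟨E, hE0, hE⟩ := EvolutionEq.exists_decay_zero hT ha2 hD0 hD'
    obtain ⟨E', hE'0, hE'⟩ := EvolutionEq.exists_decay_of_one_le hT (ContinuousLinearMap.id ℂ X)
      (by linarith) hE0 hE
    refine ⟨E', -(a / 2), hE'0, by linarith, fun x t ht => (hE' x t ht).trans ?_⟩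
    gcongr
    exact le_add_of_nonneg_right (norm_nonneg _)
  rcases hα1.eq_or_lt with rfl | hα1'
  · obtain ⟨E, hE0, hE⟩ := EvolutionEq.exists_decay_one hT ha hAK (by linarith) ha2 hD0 hD'
    obtain ⟨E', hE'0, hE'⟩ := EvolutionEq.exists_decay_of_one_le hT _ (by linarith) hE0 hE
    rw [EvolutionEq.fracPow_one]
    refine ⟨E', -(a / 2 / 2), hE'0, by linarith, fun x t ht => ?_⟩
    -- Writing `x = R(1)(x - Ax)` brings in the graph norm of `-A`.
    have h1 : EvolutionEq.resolvent (EvolutionEq.generator T) ((1 : ℝ) : ℂ)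
        ((x : X) - EvolutionEq.generator T x) = x := by
      simpa using (EvolutionEq.isResolventAt_resolvent
        (hρ ((1 : ℝ) : ℂ) (by simp))).left_inv x
    have h2 := hE' ((x : X) - EvolutionEq.generator T x) t ht
    rw [h1] at h2
    refine h2.trans ?_
    gcongr
    refine (norm_sub_le _ _).trans_eq ?_
    rw [EvolutionEq.graphNorm, LinearPMap.neg_apply, norm_neg]
  · obtain ⟨E, η, hE0, hη, hE⟩ := EvolutionEq.exists_decay_negFracPow hT ha hAK hα0' hα1'
      (by linarith) ha2 hD0 hD'
    obtain ⟨E', hE'0, hE'⟩ := EvolutionEq.exists_decay_of_one_le hT _ hη.le hE0 hE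
    obtain ⟨C, hC0, hC⟩ := EvolutionEq.exists_resolvent_real_decay hT ha hAK
    refine ⟨E', -η, hE'0, by linarith, fun x t ht => ?_⟩
    have h1 := EvolutionEq.negFracPow_fracPow_apply hα0' hα1' (fun y hy =>
      EvolutionEq.eq_zero_of_negFracPow_apply_eq_zero ha hAK hC0.le hC hα0' hα1' hy) x
    have h2 := hE' (EvolutionEq.fracPow (EvolutionEq.generator T) α x) t ht
    rw [h1] at h2
    refine h2.trans ?_
    gcongr
    exact le_add_of_nonneg_left (norm_nonneg _)
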